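/- We consider MLL formulas built from the literals $p$ and $p^{\perp}$ with the connectives $\otimes$ (tensor) and $\wp$ (par). An indexed formula (formula occurrence) is a pair $\langle F,i\rangle$ of a formula $F$ and an index $i\in\mathbb N$. A link is either an ID-link with conclusions $\langle p,i\rangle,\langle p^{\perp},j\rangle$, or a $\otimes$-link (resp. $\wp$-link) with left premise $\langle A,i\rangle$, right premise $\langle B,j\rangle$ and conclusion $\langle A\otimes B,k\rangle$ (resp. $\langle A \wp B,k\rangle$). A proof structure $\Theta=\langle\mathbb F,\mathbb L\rangle$ consists of a finite set $\mathbb F$ of occurrences and a finite set $\mathbb L$ of links whose premises and conclusions lie in $\mathbb F$, such that different occurrences have different indices, the two premises of a $\otimes$- or $\wp$-link are different occurrences, every occurrence is a premise of at most one link, and every occurrence is a conclusion of exactly one link. A conclusion of $\Theta$ is an occurrence in $\mathbb F$ that is not a premise of any link in $\mathbb L$. A proof structure is a proof net if it is sequentializable, where sequentializability is defined inductively: $\Theta$ is sequentializable if (1) $\mathbb L$ consists of a single ID-link; or (2) there is a $\wp$-link $L\in\mathbb L$ whose conclusion $c$ is a conclusion of $\Theta$ and $\langle\mathbb F\setminus\{c\},\mathbb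 L\setminus\{L\}\rangle$ is a sequentializable proof structure; or (3) there is a $\otimes$-link $L\in\mathbb L$ whose conclusion $c$ is a conclusion of $\Theta$, and $\mathbb F=\mathbb F_1\uplus\mathbb F_2\uplus\{c\}$, $\mathbb L=\mathbb L_1\uplus\mathbb L_2\uplus\{L\}$ with $\langle\mathbb F_1,\mathbb L_1\rangle$ and $\langle\mathbb F_2,\mathbb L_2\rangle$ sequentializable proof structures, the left premise of $L$ lying in $\mathbb F_1$ and the right premise in $\mathbb F_2$. The directed graph $G(\Theta)$ has as vertices the indices of the occurrences of $\Theta$, and the following labelled edges: for each ID-link an edge labelled $\mathbf{ID}$ from the index of its conclusion $p$ to the index of its conclusion $p^{\perp}$; for each $\otimes$- or $\wp$-link an edge labelled $\mathbf L$ from the index of its left premise, and an edge labelled $\mathbf R$ from the index of its right premise, to the index of its conclusion. Two proof structures belong to the same PS-family if there is an isomorphism of directed graphs, preserving edge labels, between $G(\Theta)$ and $G(\Theta')$. They are regarded as equal, $\Theta=\Theta'$, if there is such an isomorphism that moreover preserves the vertex labelling which sends the index of an occurrence $F$ to $p$, $p^{\perp}$, $\otimes$ or $\wp$ according to whether $F$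 is $p$, $p^{\perp}$, a $\otimes$-formula or a $\wp$-formula. We write $\Theta_1\Leftrightarrow\Theta_2$ if, for some $\otimes$-link and some $\wp$-link of $\Theta_1$, the proof structure $\Theta_2$ is obtained (up to the above equality) from $\Theta_1$ by simultaneously replacing this $\otimes$-link by a $\wp$-link with the same premises and this $\wp$-link by a $\otimes$-link with the same premises, the formulas below being changed accordingly. **Theorem.** Let $\Theta$ and $\Theta'$ be two proof nets belonging to the same PS-family. Then either $\Theta=\Theta'$, or there are $n\in\mathbb N$ (possibly $n = 0$) and proof nets $\Theta_1,\dots,\Theta_n$ such that \[\Theta\Leftrightarrow\Theta_1\Leftrightarrow\cdots\Leftrightarrow\Theta_n\Leftrightarrow\Theta'.\] -/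

import Mathlib

namespace MLL

/-- MLL formulas over one propositional variable `p`. -/
inductive Formula : Type
  | pos : Formula
  | neg : Formula
  | tens : Formula → Formula → Formula
  | par : Formula → Formula → Formula
  deriving DecidableEq

/-- An indexed formula (formula occurrence): a formula together with its index. -/
abbrev IndexedFormula : Type := Formula × ℕ

/-- MLL links.
* `ident i j` is the ID-link with conclusions `⟨p, i⟩` and `⟨p^⊥, j⟩`;
* `tens A B i j k` is the tensor link with left premise `⟨A, i⟩`, right premise `⟨B, j⟩` and
  conclusion `⟨A ⊗ B, k⟩`;
* `par A B i j k` is the par link with left premise `⟨A, i⟩`, right premise `⟨B, j⟩` and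
  conclusion `⟨A ⅋ B, k⟩`. -/
inductive Link : Type
  | ident (i j : ℕ) : Link
  | tens (A B : Formula) (i j k : ℕ) : Link
  | par (A B : Formula) (i j k : ℕ) : Link
  deriving DecidableEq

namespace Link

/-- The list of premises of a link, left premise first. -/
def premises : Link → List IndexedFormula
  | ident _ _ => []
  | tens A B i j _ => [(A, i), (B, j)]
  | par A B i j _ => [(A, i), (B, j)]

/-- The list of conclusions of a link. -/
def conclusions : Link → List IndexedFormula
  | ident i j => [(Formula.pos, i), (Formula.neg, j)]
  | tens A B _ _ k => [(Formula.tens A B, k)]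
  | par A B _ _ k => [(Formula.par A B, k)]

/-- The link is an ID-link. -/
def IsIdent (L : Link) : Prop := ∃ i j, L = ident i j

/-- The link is a tensor link. -/
def IsTens (L : Link) : Prop := ∃ A B i j k, L = tens A B i j k

/-- The link is a par link. -/
def IsPar (L : Link) : Prop := ∃ A B i j k, L = par A B i j k

end Link

/-- MLL proof structures: a finite set of formula occurrences and a finite set of links. -/
structure ProofStructure : Type where
  fml : Finset IndexedFormula
  lnk : Finset Link
  premises_mem : ∀ L ∈ lnk, ∀ x ∈ L.premises, x ∈ fml
  conclusions_mem : ∀ L ∈ lnk, ∀ x ∈ L.conclusions, x ∈ fml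
  /-- The left and the right premise of a link are two different occurrences. -/
  premises_nodup : ∀ L ∈ lnk, L.premises.Nodup
  /-- Different occurrences have different indices. -/
  index_inj : ∀ x ∈ fml, ∀ y ∈ fml, x.2 = y.2 → x = y
  /-- An occurrence is a premise of at most one link. -/
  premise_unique : ∀ x ∈ fml, ∀ L ∈ lnk, ∀ L' ∈ lnk, x ∈ L.premises → x ∈ L'.premises → L = L'
  /-- An occurrence is a conclusion of exactly one link. -/
  conclusion_unique : ∀ x ∈ fml, ∃! L, L ∈ lnk ∧ x ∈ L.conclusions

namespace ProofStructure

/-- `x` is a conclusion of the proof structure. -/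
def IsConclusion (Θ : ProofStructure) (x : IndexedFormula) : Prop :=
  x ∈ Θ.fml ∧ ∀ L ∈ Θ.lnk, x ∉ L.premises

/-- Sequentializable proof structures.  In the tensor case the two parts are disjoint, the left
premise of the removed link lies in the first one and the right premise in the second one. -/
inductive Sequentializable : ProofStructure → Prop
  | ident (Θ : ProofStructure) (L : Link) (hL : L.IsIdent) (hlnk : Θ.lnk = {L}) :
      Sequentializable Θ
  | par (Θ Θ₀ : ProofStructure) (A B : Formula) (i j k : ℕ)
      (hL : Link.par A B i j k ∈ Θ.lnk)
      (hconc : Θ.IsConclusion (Formula.par A B, k))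
      (hfml : Θ₀.fml = Θ.fml \ {(Formula.par A B, k)})
      (hlnk : Θ₀.lnk = Θ.lnk \ {Link.par A B i j k})
      (hseq : Sequentializable Θ₀) :
      Sequentializable Θ
  | tens (Θ Θ₁ Θ₂ : ProofStructure) (A B : Formula) (i j k : ℕ)
      (hL : Link.tens A B i j k ∈ Θ.lnk)
      (hconc : Θ.IsConclusion (Formula.tens A B, k))
      (hleft : (A, i) ∈ Θ₁.fml)
      (hright : (B, j) ∈ Θ₂.fml)
      (hfml_disj : Disjoint Θ₁.fml Θ₂.fml)
      (hfml₁ : (Formula.tens A B, k) ∉ Θ₁.fml)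
      (hfml₂ : (Formula.tens A B, k) ∉ Θ₂.fml)
      (hfml : Θ.fml = Θ₁.fml ∪ Θ₂.fml ∪ {(Formula.tens A B, k)})
      (hlnk_disj : Disjoint Θ₁.lnk Θ₂.lnk)
      (hlnk₁ : Link.tens A B i j k ∉ Θ₁.lnk)
      (hlnk₂ : Link.tens A B i j k ∉ Θ₂.lnk)
      (hlnk : Θ.lnk = Θ₁.lnk ∪ Θ₂.lnk ∪ {Link.tens A B i j k})
      (hseq₁ : Sequentializable Θ₁)
      (hseq₂ : Sequentializable Θ₂) :
      Sequentializable Θ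

/-- MLL proof nets. -/
def IsProofNet (Θ : ProofStructure) : Prop := Sequentializable Θ

end ProofStructure

/-- Vertex labels. -/
inductive VLabel : Type
  | pos : VLabel
  | neg : VLabel
  | tens : VLabel
  | par : VLabel
  deriving DecidableEq

/-- Edge labels. -/
inductive ELabel : Type
  | left : ELabel
  | right : ELabel
  | ident : ELabel
  deriving DecidableEq

/-- The strip function: the literal itself, or the main connective. -/
def strip : Formula → VLabel
  | Formula.pos => VLabel.pos
  | Formula.neg => VLabel.neg
  | Formula.tens _ _ => VLabel.tens
  | Formula.par _ _ => VLabel.par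

/-- Directed graphs whose edges carry labels in `ELabel`. -/
structure EdgeLabelledDigraph : Type 1 where
  V : Type
  E : Type
  src : E → V
  tgt : E → V
  labelE : E → ELabel

/-- Directed graphs whose vertices carry labels in `VLabel` and edges carry labels in `ELabel`. -/
structure LabelledDigraph : Type 1 extends EdgeLabelledDigraph where
  labelV : V → VLabel

/-- Graph isomorphisms that respect sources, targets and edge labels. -/
structure EdgeLabelledDigraph.Iso (G H : EdgeLabelledDigraph) : Type where
  onV : G.V ≃ H.V
  onE : G.E ≃ H.E
  src_eq : ∀ e, onV (G.src e) = H.src (onE e)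
  tgt_eq : ∀ e, onV (G.tgt e) = H.tgt (onE e)
  labelE_eq : ∀ e, G.labelE e = H.labelE (onE e)

/-- Graph isomorphisms that moreover respect vertex labels. -/
structure LabelledDigraph.Iso (G H : LabelledDigraph) : Type extends
    EdgeLabelledDigraph.Iso G.toEdgeLabelledDigraph H.toEdgeLabelledDigraph where
  labelV_eq : ∀ v, G.labelV v = H.labelV (onV v)

/-- The edges `(source, label, target)` generated by a link. -/
def Link.edges : Link → List (ℕ × ELabel × ℕ)
  | Link.ident i j => [(i, ELabel.ident, j)]
  | Link.tens _ _ i j k => [(i, ELabel.left, k), (j, ELabel.right, k)]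
  | Link.par _ _ i j k => [(i, ELabel.left, k), (j, ELabel.right, k)]

namespace ProofStructure

theorem edge_src_mem (Θ : ProofStructure) {L : Link} (hL : L ∈ Θ.lnk)
    {e : ℕ × ELabel × ℕ} (he : e ∈ L.edges) : ∃ A, (A, e.1) ∈ Θ.fml := by
  have hp := Θ.premises_mem L hL
  have hc := Θ.conclusions_mem L hL
  cases L <;> simp [Link.edges] at he
  · subst he
    exact ⟨Formula.pos, hc _ (by simp [Link.conclusions])⟩
  all_goals
    rcases he with rfl | rfl
    · exact ⟨_, hp _ (List.mem_cons_self ..)⟩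
    · exact ⟨_, hp _ (List.mem_cons_of_mem _ (List.mem_cons_self ..))⟩

theorem edge_tgt_mem (Θ : ProofStructure) {L : Link} (hL : L ∈ Θ.lnk)
    {e : ℕ × ELabel × ℕ} (he : e ∈ L.edges) : ∃ A, (A, e.2.2) ∈ Θ.fml := by
  have hc := Θ.conclusions_mem L hL
  cases L <;> simp [Link.edges] at he
  · subst he
    exact ⟨Formula.neg, hc _ (by simp [Link.conclusions])⟩
  all_goals
    rcases he with rfl | rfl <;> exact ⟨_, hc _ (List.mem_cons_self ..)⟩

/-- The directed graph induced by a proof structure: its vertices are the indices of the formula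
occurrences, its edges those generated by the links. -/
def graph (Θ : ProofStructure) : EdgeLabelledDigraph where
  V := {i : ℕ // ∃ A, (A, i) ∈ Θ.fml}
  E := {e : ℕ × ELabel × ℕ // ∃ L ∈ Θ.lnk, e ∈ L.edges}
  src e := ⟨e.1.1, e.2.elim fun _ h => Θ.edge_src_mem h.1 h.2⟩
  tgt e := ⟨e.1.2.2, e.2.elim fun _ h => Θ.edge_tgt_mem h.1 h.2⟩
  labelE e := e.1.2.1

/-- The induced directed graph in which the vertex `i` of an occurrence `⟨A, i⟩` carries the
label `f A`. -/
noncomputable def labelledGraph (f : Formula → VLabel) (Θ : ProofStructure) : LabelledDigraph where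
  toEdgeLabelledDigraph := Θ.graph
  labelV v := f v.2.choose

/-- Two proof structures belong to the same PS-family: their induced directed graphs, without
vertex labels, are isomorphic. -/
def SameFamily (Θ₁ Θ₂ : ProofStructure) : Prop := Nonempty (Θ₁.graph.Iso Θ₂.graph)

/-- Equality of proof structures (independence of the choice of indices): the induced directed
graphs with stripped formulas as vertex labels are isomorphic. -/
def Equal (Θ₁ Θ₂ : ProofStructure) : Prop :=
  Nonempty ((Θ₁.labelledGraph strip).Iso (Θ₂.labelledGraph strip))

open Classical in
/-- The formula carried by the occurrence `⟨F, k⟩` of `Θ` after every multiplicative link in `S`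
has been replaced by its dual. -/
noncomputable def relabel (Θ : ProofStructure) (S : Set Link) : Formula → ℕ → Formula
  | Formula.pos, _ => Formula.pos
  | Formula.neg, _ => Formula.neg
  | Formula.tens A B, k =>
      if h : ∃ ij : ℕ × ℕ, Link.tens A B ij.1 ij.2 k ∈ Θ.lnk then
        if Link.tens A B h.choose.1 h.choose.2 k ∈ S then
          Formula.par (relabel Θ S A h.choose.1) (relabel Θ S B h.choose.2)
        else
          Formula.tens (relabel Θ S A h.choose.1) (relabel Θ S B h.choose.2)
      else Formula.tens A B
  | Formula.par A B, k =>
      if h : ∃ ij : ℕ × ℕ, Link.par A B ij.1 ij.2 k ∈ Θ.lnk then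
        if Link.par A B h.choose.1 h.choose.2 k ∈ S then
          Formula.tens (relabel Θ S A h.choose.1) (relabel Θ S B h.choose.2)
        else
          Formula.par (relabel Θ S A h.choose.1) (relabel Θ S B h.choose.2)
      else Formula.par A B

/-- The occurrence, with the same index, that replaces the occurrence `x`. -/
noncomputable def relabelOcc (Θ : ProofStructure) (S : Set Link) (x : IndexedFormula) :
    IndexedFormula :=
  (Θ.relabel S x.1 x.2, x.2)

open Classical in
/-- The link that replaces the link `L`: it is dual to `L` if `L ∈ S`, and of the same kind as
`L` otherwise. -/
noncomputable def relabelLink (Θ : ProofStructure) (S : Set Link) : Link → Link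
  | Link.ident i j => Link.ident i j
  | Link.tens A B i j k =>
      if Link.tens A B i j k ∈ S then
        Link.par (Θ.relabel S A i) (Θ.relabel S B j) i j k
      else
        Link.tens (Θ.relabel S A i) (Θ.relabel S B j) i j k
  | Link.par A B i j k =>
      if Link.par A B i j k ∈ S then
        Link.tens (Θ.relabel S A i) (Θ.relabel S B j) i j k
      else
        Link.par (Θ.relabel S A i) (Θ.relabel S B j) i j k

theorem relabelOcc_injOn (Θ : ProofStructure) (S : Set Link) {x y : IndexedFormula}
    (hx : x ∈ Θ.fml) (hy : y ∈ Θ.fml) (h : Θ.relabelOcc S x = Θ.relabelOcc S y) : x = y :=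
  Θ.index_inj x hx y hy (by simpa [relabelOcc] using (Prod.ext_iff.1 h).2)

theorem premises_relabelLink (Θ : ProofStructure) (S : Set Link) (L : Link) :
    (Θ.relabelLink S L).premises = L.premises.map (Θ.relabelOcc S) := by
  cases L <;> simp only [relabelLink] <;> (try split_ifs) <;> rfl

theorem conclusions_relabelLink (Θ : ProofStructure) (S : Set Link) {L : Link}
    (hL : L ∈ Θ.lnk) :
    (Θ.relabelLink S L).conclusions = L.conclusions.map (Θ.relabelOcc S) := by
  cases L with
  | ident i j => rfl
  | tens A B i j k =>
    have h : ∃ ij : ℕ × ℕ, Link.tens A B ij.1 ij.2 k ∈ Θ.lnk := ⟨(i, j), hL⟩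
    have e : Link.tens A B h.choose.1 h.choose.2 k = Link.tens A B i j k :=
      (Θ.conclusion_unique (Formula.tens A B, k)
        (Θ.conclusions_mem _ hL _ (List.mem_cons_self ..))).unique
        ⟨h.choose_spec, List.mem_cons_self ..⟩ ⟨hL, List.mem_cons_self ..⟩
    have e₁ : h.choose.1 = i := by injection e
    have e₂ : h.choose.2 = j := by injection e
    by_cases hS : Link.tens A B i j k ∈ S
    · have hS' : Link.tens A B h.choose.1 h.choose.2 k ∈ S := e ▸ hS
      simp only [relabelLink, if_pos hS, Link.conclusions, List.map, relabelOcc, relabel,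
        dif_pos h, if_pos hS', e₁, e₂]
    · have hS' : Link.tens A B h.choose.1 h.choose.2 k ∉ S := e ▸ hS
      simp only [relabelLink, if_neg hS, Link.conclusions, List.map, relabelOcc, relabel,
        dif_pos h, if_neg hS', e₁, e₂]
  | par A B i j k =>
    have h : ∃ ij : ℕ × ℕ, Link.par A B ij.1 ij.2 k ∈ Θ.lnk := ⟨(i, j), hL⟩
    have e : Link.par A B h.choose.1 h.choose.2 k = Link.par A B i j k :=
      (Θ.conclusion_unique (Formula.par A B, k)
        (Θ.conclusions_mem _ hL _ (List.mem_cons_self ..))).unique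
        ⟨h.choose_spec, List.mem_cons_self ..⟩ ⟨hL, List.mem_cons_self ..⟩
    have e₁ : h.choose.1 = i := by injection e
    have e₂ : h.choose.2 = j := by injection e
    by_cases hS : Link.par A B i j k ∈ S
    · have hS' : Link.par A B h.choose.1 h.choose.2 k ∈ S := e ▸ hS
      simp only [relabelLink, if_pos hS, Link.conclusions, List.map, relabelOcc, relabel,
        dif_pos h, if_pos hS', e₁, e₂]
    · have hS' : Link.par A B h.choose.1 h.choose.2 k ∉ S := e ▸ hS
      simp only [relabelLink, if_neg hS, Link.conclusions, List.map, relabelOcc, relabel,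
        dif_pos h, if_neg hS', e₁, e₂]

/-- The proof structure obtained from `Θ` by simultaneously replacing every tensor link in `S` by
the par link, and every par link in `S` by the tensor link, with the same premises; indices are
kept and the formulas below the replaced links are updated accordingly. -/
noncomputable def replaceLinks (Θ : ProofStructure) (S : Set Link) : ProofStructure where
  fml := Θ.fml.image (Θ.relabelOcc S)
  lnk := Θ.lnk.image (Θ.relabelLink S)
  premises_mem := by
    intro L' hL' x' hx'
    obtain ⟨L, hL, rfl⟩ := Finset.mem_image.1 hL'
    rw [premises_relabelLink] at hx'
    obtain ⟨x, hx, rfl⟩ := List.mem_map.1 hx'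
    exact Finset.mem_image_of_mem _ (Θ.premises_mem L hL x hx)
  conclusions_mem := by
    intro L' hL' x' hx'
    obtain ⟨L, hL, rfl⟩ := Finset.mem_image.1 hL'
    rw [conclusions_relabelLink Θ S hL] at hx'
    obtain ⟨x, hx, rfl⟩ := List.mem_map.1 hx'
    exact Finset.mem_image_of_mem _ (Θ.conclusions_mem L hL x hx)
  premises_nodup := by
    intro L' hL'
    obtain ⟨L, hL, rfl⟩ := Finset.mem_image.1 hL'
    rw [premises_relabelLink]
    exact (Θ.premises_nodup L hL).map_on fun x hx y hy h =>
      Θ.relabelOcc_injOn S (Θ.premises_mem L hL x hx) (Θ.premises_mem L hL y hy) h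
  index_inj := by
    intro x' hx' y' hy' h
    obtain ⟨x, hx, rfl⟩ := Finset.mem_image.1 hx'
    obtain ⟨y, hy, rfl⟩ := Finset.mem_image.1 hy'
    rw [Θ.index_inj x hx y hy h]
  premise_unique := by
    intro x' _ L₁' hL₁' L₂' hL₂' h₁ h₂
    obtain ⟨L₁, hL₁, rfl⟩ := Finset.mem_image.1 hL₁'
    obtain ⟨L₂, hL₂, rfl⟩ := Finset.mem_image.1 hL₂'
    rw [premises_relabelLink] at h₁ h₂
    obtain ⟨x, hx, rfl⟩ := List.mem_map.1 h₁
    obtain ⟨y, hy, hxy⟩ := List.mem_map.1 h₂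
    have hxm := Θ.premises_mem L₁ hL₁ x hx
    have e := Θ.relabelOcc_injOn S (Θ.premises_mem L₂ hL₂ y hy) hxm hxy
    subst e
    rw [Θ.premise_unique y hxm L₁ hL₁ L₂ hL₂ hx hy]
  conclusion_unique := by
    intro x' hx'
    obtain ⟨x, hx, rfl⟩ := Finset.mem_image.1 hx'
    obtain ⟨L, ⟨hL, hxL⟩, huniq⟩ := Θ.conclusion_unique x hx
    refine ⟨Θ.relabelLink S L, ⟨Finset.mem_image_of_mem _ hL, ?_⟩, ?_⟩
    · rw [conclusions_relabelLink Θ S hL]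
      exact List.mem_map_of_mem hxL
    · rintro L' ⟨hL', hx'⟩
      obtain ⟨L₂, hL₂, rfl⟩ := Finset.mem_image.1 hL'
      rw [conclusions_relabelLink Θ S hL₂] at hx'
      obtain ⟨y, hy, hxy⟩ := List.mem_map.1 hx'
      have e := Θ.relabelOcc_injOn S (Θ.conclusions_mem L₂ hL₂ y hy) hx hxy
      subst e
      rw [huniq L₂ ⟨hL₂, hy⟩]

/-- The tensor-par-exchange of `Θ` by the links `Lt` and `Lp`. -/
noncomputable def tpex (Θ : ProofStructure) (Lt Lp : Link) : ProofStructure :=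
  Θ.replaceLinks {Lt, Lp}

/-- `Θ₁ ⇔ Θ₂`: for some tensor link and some par link of `Θ₁`, the proof structure `Θ₂` is (equal
as a proof structure to) the tensor-par-exchange of `Θ₁` by these two links. -/
def Exchange (Θ₁ Θ₂ : ProofStructure) : Prop :=
  ∃ Lt ∈ Θ₁.lnk, ∃ Lp ∈ Θ₁.lnk, Lt.IsTens ∧ Lp.IsPar ∧ Θ₂.Equal (Θ₁.tpex Lt Lp)

end ProofStructure

end MLL

/-! Up to renaming of indices, the members of a PS-family share one set `L` of stripped links and
differ only in the set `T` of conclusions of their tensor links. `ANet T L` is sequentializability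
in these terms, and an exchange replaces `T` by `insert s (T \ {t})`.

The core is `ANet.splits_or_exchange`: a terminal tensor `k` of a net either splits it, or can be
swapped with some par so that a net results. For suppose that `k` splits a net into two halves and a
new par `m` bridges them. Then `m` read as a tensor joins the halves, and `k` read as a par can be
added afterwards, since both its premises now lie in one net.

Two nets `T` and `T'` on `L` are then joined by induction on a sequentialization of `T`
(`ANet.chain_of_agree`). Let `k` be the conclusion of its last link. If that link is a par in both
nets, it is removed from both. If it is a par only in `T`, it cannot split `T'`, because the rest of
`L` is connected; so an exchange in `T'` turns it into a par. If it is a tensor in `T`, the rest is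
disconnected, so no net on `L` has it as a par; hence it splits `T'` as well. By connectedness the
two halves are the same in both nets, and they are treated one after the other.

`Sequentializable.anet` and `sequentializable_of_anet` carry nets back and forth between proof
structures and stripped links; a graph isomorphism is turned into a renaming of indices. -/

namespace MLL

/-! ### Stripped links -/

/-- A link stripped of its formulas and of its kind: only the indices remain. -/
inductive Arc : Type
  | ident (i j : ℕ) : Arc
  | node (i j k : ℕ) : Arc

namespace Arc

/-- The indices of the premises. -/
def prem : Arc → Set ℕ
  | ident _ _ => ∅
  | node i j _ => {i, j}

/-- The indices of the conclusions. -/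
def concl : Arc → Set ℕ
  | ident i j => {i, j}
  | node _ _ k => {k}

/-- Renaming of indices. -/
def map (g : ℕ → ℕ) : Arc → Arc
  | ident i j => ident (g i) (g j)
  | node i j k => node (g i) (g j) (g k)

theorem concl_nonempty (a : Arc) : a.concl.Nonempty := by
  cases a <;> simp [concl]

/-- The indices of the conclusions of the links in a set. -/
def verts (L : Set Arc) : Set ℕ := {v | ∃ a ∈ L, v ∈ a.concl}

/-- The indices of the conclusions of the multiplicative links in a set. -/
def nodes (L : Set Arc) : Set ℕ := {k | ∃ i j, node i j k ∈ L}

/-- The indices of the premises of the links in a set. -/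
def prems (L : Set Arc) : Set ℕ := {v | ∃ a ∈ L, v ∈ a.prem}

theorem verts_mono {L M : Set Arc} (h : L ⊆ M) : verts L ⊆ verts M :=
  fun _ ⟨a, ha, hv⟩ => ⟨a, h ha, hv⟩

theorem nodes_mono {L M : Set Arc} (h : L ⊆ M) : nodes L ⊆ nodes M :=
  fun _ ⟨i, j, ha⟩ => ⟨i, j, h ha⟩

theorem prems_mono {L M : Set Arc} (h : L ⊆ M) : prems L ⊆ prems M :=
  fun _ ⟨a, ha, hv⟩ => ⟨a, h ha, hv⟩

theorem nodes_subset_verts (L : Set Arc) : nodes L ⊆ verts L :=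
  fun _ ⟨_, _, h⟩ => ⟨_, h, rfl⟩

theorem mem_verts_of_node {L : Set Arc} {i j k : ℕ} (h : node i j k ∈ L) : k ∈ verts L :=
  ⟨_, h, rfl⟩

theorem mem_prems_left {L : Set Arc} {i j k : ℕ} (h : node i j k ∈ L) : i ∈ prems L :=
  ⟨_, h, Or.inl rfl⟩

theorem mem_prems_right {L : Set Arc} {i j k : ℕ} (h : node i j k ∈ L) : j ∈ prems L :=
  ⟨_, h, Or.inr rfl⟩

@[simp]
theorem verts_insert_node (L : Set Arc) (i j k : ℕ) :
    verts (insert (node i j k) L) = insert k (verts L) := by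
  ext v; simp [verts, concl]

@[simp]
theorem verts_union (L M : Set Arc) : verts (L ∪ M) = verts L ∪ verts M := by
  ext v; simp [verts, or_and_right, exists_or]

theorem concl_map (g : ℕ → ℕ) (a : Arc) : (a.map g).concl = g '' a.concl := by
  cases a <;> simp [map, concl, Set.image_insert_eq]

theorem verts_image (g : ℕ → ℕ) (L : Set Arc) : verts (map g '' L) = g '' verts L := by
  ext v
  constructor
  · rintro ⟨_, ⟨a, ha, rfl⟩, hv⟩
    rw [concl_map] at hv
    obtain ⟨w, hw, rfl⟩ := hv
    exact ⟨w, ⟨a, ha, hw⟩, rfl⟩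
  · rintro ⟨w, ⟨a, ha, hw⟩, rfl⟩
    exact ⟨_, ⟨a, ha, rfl⟩, concl_map g a ▸ ⟨w, hw, rfl⟩⟩

theorem insert_cancel {L M : Set Arc} {a : Arc} (h : insert a L = insert a M) (hL : a ∉ L)
    (hM : a ∉ M) : L = M := by
  rw [← Set.insert_sdiff_self_of_notMem hL, h, Set.insert_sdiff_self_of_notMem hM]

end Arc

open Arc

/-! ### Nets on stripped links and their connectedness -/

/-- Sequentializability of a set of stripped links, where `T` is the set of the conclusions of the
tensor links. -/
inductive ANet (T : Set ℕ) : Set Arc → Prop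
  | ident (i j : ℕ) : ANet T {Arc.ident i j}
  | par {L : Set Arc} {i j k : ℕ} (h : ANet T L) (hi : i ∈ verts L) (hj : j ∈ verts L)
      (hk : k ∉ verts L) (hT : k ∉ T) : ANet T (insert (node i j k) L)
  | tens {L M : Set Arc} {i j k : ℕ} (hL : ANet T L) (hM : ANet T M)
      (hd : Disjoint (verts L) (verts M)) (hi : i ∈ verts L) (hj : j ∈ verts M)
      (hkL : k ∉ verts L) (hkM : k ∉ verts M) (hT : k ∈ T) :
      ANet T (insert (node i j k) (L ∪ M))

namespace ANet

variable {T T' : Set ℕ} {L M M' : Set Arc} {i j k : ℕ}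

theorem prem_subset (h : ANet T L) : ∀ a ∈ L, a.prem ⊆ verts L := by
  induction h with
  | ident i j => rintro a rfl; simp [prem]
  | @par L i j k h hi hj hk hT ih =>
    rintro a (rfl | ha)
    · rintro v (rfl | rfl) <;> simp [*]
    · exact (ih a ha).trans (verts_mono (Set.subset_insert ..))
  | @tens L M i j k hL hM hd hi hj hkL hkM hT ihL ihM =>
    rintro a (rfl | ha | ha)
    · rintro v (rfl | rfl) <;> simp [*]
    · exact (ihL a ha).trans (by intro v hv; simp [hv])
    · exact (ihM a ha).trans (by intro v hv; simp [hv])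

/-- A derivation consults `T` only at the conclusions of its multiplicative links, so exchanges
elsewhere leave a net intact. -/
theorem congr (h : ANet T L) (hT : ∀ v ∈ nodes L, v ∈ T ↔ v ∈ T') : ANet T' L := by
  induction h with
  | ident i j => exact .ident i j
  | @par L i j k h hi hj hk hkT ih =>
    refine .par (ih fun v hv => hT v (nodes_mono (Set.subset_insert ..) hv)) hi hj hk ?_
    rwa [← hT k ⟨i, j, Set.mem_insert ..⟩]
  | @tens L M i j k hL hM hd hi hj hkL hkM hkT ihL ihM =>
    refine .tens (ihL fun v hv => hT v (nodes_mono ?_ hv))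
      (ihM fun v hv => hT v (nodes_mono ?_ hv)) hd hi hj hkL hkM ?_
    · intro a ha; simp [ha]
    · intro a ha; simp [ha]
    · rwa [← hT k ⟨i, j, Set.mem_insert ..⟩]

/-- The net is connected. -/
theorem connected (h : ANet T L) (W : Set ℕ)
    (hW : ∀ a ∈ L, ∀ v ∈ a.prem ∪ a.concl, ∀ w ∈ a.prem ∪ a.concl, v ∈ W → w ∈ W) :
    ∀ v ∈ verts L, ∀ w ∈ verts L, v ∈ W → w ∈ W := by
  induction h with
  | ident i j =>
    rintro v ⟨_, rfl, hv⟩ w ⟨_, rfl, hw⟩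
    exact hW _ rfl v (Or.inr hv) w (Or.inr hw)
  | @par L i j k h hi hj hk hT ih =>
    have ih := ih fun a ha => hW a (Or.inr ha)
    have hn := hW _ (Or.inl rfl)
    have h1 : i ∈ W ↔ k ∈ W := ⟨hn i (by simp [prem]) k (by simp [concl]),
      hn k (by simp [concl]) i (by simp [prem])⟩
    rw [verts_insert_node]
    rintro v (rfl | hv) w (rfl | hw) hvW
    · exact hvW
    · exact ih i hi w hw (h1.2 hvW)
    · exact h1.1 (ih v hv i hi hvW)
    · exact ih v hv w hw hvW
  | @tens L M i j k hL hM hd hi hj hkL hkM hT ihL ihM =>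
    have ihL := ihL fun a ha => hW a (by simp [ha])
    have ihM := ihM fun a ha => hW a (by simp [ha])
    have hn := hW _ (Or.inl rfl)
    have h1 : i ∈ W ↔ k ∈ W := ⟨hn i (by simp [prem]) k (by simp [concl]),
      hn k (by simp [concl]) i (by simp [prem])⟩
    have h2 : j ∈ W ↔ k ∈ W := ⟨hn j (by simp [prem]) k (by simp [concl]),
      hn k (by simp [concl]) j (by simp [prem])⟩
    have key : ∀ v ∈ verts (insert (node i j k) (L ∪ M)), v ∈ W ↔ k ∈ W := by
      rw [verts_insert_node, verts_union]
      rintro v (rfl | hv | hv)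
      · rfl
      · exact ⟨fun h => h1.1 (ihL v hv i hi h), fun h => ihL i hi v hv (h1.2 h)⟩
      · exact ⟨fun h => h2.1 (ihM v hv j hj h), fun h => ihM j hj v hv (h2.2 h)⟩
    intro v hv w hw hvW
    exact (key w hw).2 ((key v hv).1 hvW)

/-- No link of `M ∪ M'` has vertices in both parts, so `verts M` is closed along the links of `L`.
Connectedness of `L` then confines it to the part containing `i`. -/
theorem subset_of_disjoint_parts (h : ANet T L) (hM : ∀ a ∈ M, a.prem ⊆ verts M)
    (hM' : ∀ a ∈ M', a.prem ⊆ verts M') (hd : Disjoint (verts M) (verts M'))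
    (hLM : L ⊆ M ∪ M') (hi : i ∈ verts L) (hiM : i ∈ verts M) : L ⊆ M := by
  have hV : ∀ w ∈ verts L, w ∈ verts M := by
    refine fun w hw => h.connected (verts M) ?_ i hi w hw hiM
    intro a ha v hv w hw hvM
    rcases hLM ha with ha | ha
    · rcases hw with hw | hw
      · exact hM a ha hw
      · exact ⟨a, ha, hw⟩
    · refine absurd hvM (Set.disjoint_right.1 hd ?_)
      rcases hv with hv | hv
      · exact hM' a ha hv
      · exact ⟨a, ha, hv⟩
  intro a ha
  rcases hLM ha with h' | h'
  · exact h'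
  · obtain ⟨v, hv⟩ := a.concl_nonempty
    exact absurd (hV v ⟨a, ha, hv⟩) (Set.disjoint_right.1 hd ⟨a, h', hv⟩)

/-- A net is not the disjoint union of two nets. -/
theorem not_union (h : ANet T (L ∪ M)) (hL : ANet T' L) (hM : ANet T' M)
    (hd : Disjoint (verts L) (verts M)) (hi : i ∈ verts L) (hj : j ∈ verts M) : False := by
  have h1 := h.subset_of_disjoint_parts hL.prem_subset hM.prem_subset hd subset_rfl
    (i := i) (by simp [hi]) hi
  exact Set.disjoint_right.1 hd hj (verts_mono (Set.subset_union_right.trans h1) hj)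

/-! ### Terminal links: removal, splitting and exchange -/

/-- A par link whose conclusion is a conclusion of the net can be removed. -/
theorem remove_par (h : ANet T L) (hn : node i j k ∈ L) (hT : k ∉ T) (hP : k ∉ prems L) :
    ∃ L₀, L = insert (node i j k) L₀ ∧ ANet T L₀ ∧ k ∉ verts L₀ := by
  induction h with
  | ident i j => simp at hn
  | @par L a b m h ha hb hm hmT ih =>
    by_cases e : node i j k = node a b m
    · obtain ⟨rfl, rfl, rfl⟩ := Arc.node.inj e
      exact ⟨L, rfl, h, hm⟩
    have hn := hn.resolve_left e
    obtain ⟨L₀, rfl, h₀, hk₀⟩ := ih hn fun hk => hP (prems_mono (Set.subset_insert ..) hk)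
    -- The last link does not use `k`, so it can still be added after `node i j k` has been removed.
    have hak : a ≠ k := fun e => hP (e ▸ mem_prems_left (Set.mem_insert ..))
    have hbk : b ≠ k := fun e => hP (e ▸ mem_prems_right (Set.mem_insert ..))
    simp only [verts_insert_node, Set.mem_insert_iff, not_or] at ha hb hm
    exact ⟨insert (node a b m) L₀, Set.insert_comm .., .par h₀ (ha.resolve_left hak)
      (hb.resolve_left hbk) hm.2 hmT, by simp [hk₀, Ne.symm hm.1]⟩
  | @tens L M a b m hL hM hd ha hb hmL hmM hmT ihL ihM =>
    have e : node i j k ≠ node a b m := fun e => hT ((Arc.node.inj e).2.2 ▸ hmT)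
    have hak : a ≠ k := fun e => hP (e ▸ mem_prems_left (Set.mem_insert ..))
    have hbk : b ≠ k := fun e => hP (e ▸ mem_prems_right (Set.mem_insert ..))
    rcases hn.resolve_left e with hn | hn
    · obtain ⟨L₀, rfl, h₀, hk₀⟩ := ihL hn fun hk => hP (prems_mono (by intro x hx; simp [hx]) hk)
      simp only [verts_insert_node, Set.mem_insert_iff, not_or, Set.disjoint_insert_left]
        at ha hmL hd
      refine ⟨insert (node a b m) (L₀ ∪ M), by rw [Set.insert_union, Set.insert_comm], .tens h₀ hM hd.2
        (ha.resolve_left hak) hb hmL.2 hmM hmT, ?_⟩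
      simp [hk₀, hd.1, Ne.symm hmL.1]
    · obtain ⟨M₀, rfl, h₀, hk₀⟩ := ihM hn fun hk => hP (prems_mono (by intro x hx; simp [hx]) hk)
      simp only [verts_insert_node, Set.mem_insert_iff, not_or, Set.disjoint_insert_right]
        at hb hmM hd
      refine ⟨insert (node a b m) (L ∪ M₀), by rw [Set.union_insert, Set.insert_comm], .tens hL h₀ hd.2
        ha (hb.resolve_left hbk) hmL hmM.2 hmT, ?_⟩
      simp [hk₀, hd.1, Ne.symm hmM.1]

/-- The tensor link `node i j k` splits the net `L`. -/
def Splits (T : Set ℕ) (L : Set Arc) (i j k : ℕ) : Prop :=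
  ∃ M N, L = insert (node i j k) (M ∪ N) ∧ ANet T M ∧ ANet T N ∧
    Disjoint (verts M) (verts N) ∧ i ∈ verts M ∧ j ∈ verts N ∧ k ∉ verts M ∧ k ∉ verts N

/-- A tensor link whose conclusion is a conclusion of the net is either splitting, or can be
exchanged with some par link. -/
theorem splits_or_exchange (h : ANet T L) (hn : node i j k ∈ L) (hT : k ∈ T)
    (hP : k ∉ prems L) :
    Splits T L i j k ∨ ∃ y ∈ nodes L, y ∉ T ∧ ANet (insert y (T \ {k})) L := by
  induction h with
  | ident i j => simp at hn
  | @par L a b m h ha hb hm hmT ih =>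
    have e : node i j k ≠ node a b m := fun e => hmT ((Arc.node.inj e).2.2 ▸ hT)
    have hn := hn.resolve_left e
    have hak : a ≠ k := fun e => hP (e ▸ mem_prems_left (Set.mem_insert ..))
    have hbk : b ≠ k := fun e => hP (e ▸ mem_prems_right (Set.mem_insert ..))
    have hkm : k ≠ m := fun e => hm (e ▸ mem_verts_of_node hn)
    rcases ih hn fun hk => hP (prems_mono (Set.subset_insert ..) hk) with
      ⟨M, N, rfl, hM, hN, hd, hi, hj, hkM, hkN⟩ | ⟨y, hy, hyT, hy'⟩
    · simp only [verts_insert_node, verts_union, Set.mem_insert_iff, Set.mem_union, not_or]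
        at ha hb hm
      -- The exchange alters `T` only at `m` and `k`, and neither is a vertex of the two halves.
      have hagree : ∀ K : Set Arc, m ∉ verts K → k ∉ verts K →
          ∀ v ∈ nodes K, v ∈ T ↔ v ∈ insert m (T \ {k}) := by
        intro K h1 h2 v hv
        have h3 := nodes_subset_verts _ hv
        have : v ≠ m := by rintro rfl; exact h1 h3
        have : v ≠ k := by rintro rfl; exact h2 h3
        simp [*]
      have hM' := hM.congr (hagree M hm.2.1 hkM)
      have hN' := hN.congr (hagree N hm.2.2 hkN)
      have hkT : k ∉ insert m (T \ {k}) := by simp [hkm]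
      -- If both premises of the par `m` lie in one half, it is absorbed there and `k` still splits.
      -- Otherwise `m` bridges the halves: as a tensor it joins them, and `k` follows as a par.
      rcases ha.resolve_left hak with ha | ha <;> rcases hb.resolve_left hbk with hb | hb
      · exact Or.inl ⟨insert (node a b m) M, N, by rw [Set.insert_comm, Set.insert_union], .par hM ha hb hm.2.1 hmT,
          hN, by simp [hd, hm], by simp [hi], hj, by simp [hkm, hkM], hkN⟩
      · refine Or.inr ⟨m, ⟨a, b, Set.mem_insert ..⟩, hmT, ?_⟩
        rw [Set.insert_comm]
        exact .par (.tens hM' hN' hd ha hb hm.2.1 hm.2.2 (Set.mem_insert ..)) (by simp [hi])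
          (by simp [hj]) (by simp [*]) hkT
      · refine Or.inr ⟨m, ⟨a, b, Set.mem_insert ..⟩, hmT, ?_⟩
        rw [Set.insert_comm, Set.union_comm]
        exact .par (.tens hN' hM' hd.symm ha hb hm.2.2 hm.2.1 (Set.mem_insert ..)) (by simp [hi])
          (by simp [hj]) (by simp [*]) hkT
      · exact Or.inl ⟨M, insert (node a b m) N, by rw [Set.insert_comm, Set.union_insert], hM,
          .par hN ha hb hm.2.2 hmT, by simp [hd, hm], hi, by simp [hj], hkM, by simp [hkm, hkN]⟩
    · refine Or.inr ⟨y, nodes_mono (Set.subset_insert ..) hy, hyT, .par hy' ha hb hm ?_⟩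
      have : m ≠ y := by rintro rfl; exact hm (nodes_subset_verts _ hy)
      simp [this, hmT]
  | @tens L M a b m hL hM hd ha hb hmL hmM hmT ihL ihM =>
    by_cases e : node i j k = node a b m
    · obtain ⟨rfl, rfl, rfl⟩ := Arc.node.inj e
      exact Or.inl ⟨L, M, rfl, hL, hM, hd, ha, hb, hmL, hmM⟩
    have hak : a ≠ k := fun e => hP (e ▸ mem_prems_left (Set.mem_insert ..))
    have hbk : b ≠ k := fun e => hP (e ▸ mem_prems_right (Set.mem_insert ..))
    have hagree : ∀ K : Set Arc, ∀ y, y ∉ verts K → k ∉ verts K →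
        ∀ v ∈ nodes K, v ∈ T ↔ v ∈ insert y (T \ {k}) := by
      intro K y h1 h2 v hv
      have h3 := nodes_subset_verts _ hv
      have : v ≠ y := by rintro rfl; exact h1 h3
      have : v ≠ k := by rintro rfl; exact h2 h3
      simp [*]
    rcases hn.resolve_left e with hn | hn
    · have hkm : k ≠ m := fun e => hmL (e ▸ mem_verts_of_node hn)
      have hkM : k ∉ verts M := Set.disjoint_left.1 hd (mem_verts_of_node hn)
      rcases ihL hn fun hk => hP (prems_mono (by intro x hx; simp [hx]) hk) with
        ⟨P, Q, rfl, hPn, hQ, hd', hi, hj, hkP, hkQ⟩ | ⟨y, hy, hyT, hy'⟩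
      · simp only [verts_insert_node, verts_union, Set.mem_insert_iff, Set.mem_union, not_or,
          Set.disjoint_insert_left, Set.disjoint_union_left] at ha hmL hd
        obtain ⟨-, hPM, hQM⟩ := hd
        -- The tensor `m` and the whole of `M` are attached to the half of `L` containing `a`; `k`
        -- still splits.
        rcases ha.resolve_left hak with ha | ha
        · refine Or.inl ⟨insert (node a b m) (P ∪ M), Q, by
            rw [Set.insert_union, Set.insert_comm, Set.insert_union, Set.union_right_comm],
            .tens hPn hM hPM ha hb hmL.2.1 hmM hmT, hQ, ?_, by simp [hi], hj, ?_, hkQ⟩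
          · simp [hmL, hd', hQM.symm]
          · simp [*]
        · refine Or.inl ⟨P, insert (node a b m) (Q ∪ M), by
            rw [Set.insert_union, Set.insert_comm, Set.union_insert, Set.union_assoc], hPn,
            .tens hQ hM hQM ha hb hmL.2.2 hmM hmT, ?_, hi, by simp [hj], hkP, ?_⟩
          · simp [hmL, hd', hPM]
          · simp [*]
      -- The exchange takes place inside `L`; the other side contains neither `y` nor `k`.
      · have hyL := nodes_subset_verts _ hy
        refine Or.inr ⟨y, nodes_mono (by intro x hx; simp [hx]) hy, hyT,
          .tens hy' (hM.congr (hagree M y (Set.disjoint_left.1 hd hyL) hkM)) hd ha hb hmL hmM ?_⟩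
        simp [hmT, Ne.symm hkm]
    · have hkm : k ≠ m := fun e => hmM (e ▸ mem_verts_of_node hn)
      have hkL : k ∉ verts L := Set.disjoint_right.1 hd (mem_verts_of_node hn)
      rcases ihM hn fun hk => hP (prems_mono (by intro x hx; simp [hx]) hk) with
        ⟨P, Q, rfl, hPn, hQ, hd', hi, hj, hkP, hkQ⟩ | ⟨y, hy, hyT, hy'⟩
      · simp only [verts_insert_node, verts_union, Set.mem_insert_iff, Set.mem_union, not_or,
          Set.disjoint_insert_right, Set.disjoint_union_right] at hb hmM hd
        obtain ⟨-, hPL, hQL⟩ := hd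
        rcases hb.resolve_left hbk with hb | hb
        · refine Or.inl ⟨insert (node a b m) (L ∪ P), Q, by
            rw [Set.union_insert, Set.insert_comm, Set.insert_union, Set.union_assoc],
            .tens hL hPn hPL ha hb hmL hmM.2.1 hmT, hQ, ?_, by simp [hi], hj, ?_, hkQ⟩
          · simp [hmM, hd', hQL]
          · simp [*]
        · refine Or.inl ⟨P, insert (node a b m) (L ∪ Q), by
            rw [Set.union_insert, Set.insert_comm, Set.union_insert, Set.union_left_comm], hPn,
            .tens hL hQ hQL ha hb hmL hmM.2.2 hmT, ?_, hi, by simp [hj], hkP, ?_⟩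
          · simp [hmM, hd', hPL.symm]
          · simp [*]
      · have hyM := nodes_subset_verts _ hy
        refine Or.inr ⟨y, nodes_mono (by intro x hx; simp [hx]) hy, hyT,
          .tens (hL.congr (hagree L y (Set.disjoint_right.1 hd hyM) hkL)) hy' hd ha hb hmL hmM ?_⟩
        simp [hmT, Ne.symm hkm]

/-! ### Chains of exchanges between nets -/

/-- `U` is obtained from `T` by exchanging a tensor link with a par link, and both are nets. -/
def Step (L : Set Arc) (T U : Set ℕ) : Prop :=
  ∃ t ∈ nodes L, ∃ s ∈ nodes L, t ∈ T ∧ s ∉ T ∧ U = insert s (T \ {t}) ∧ ANet T L ∧ ANet U L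

theorem Step.symm {T U : Set ℕ} (h : Step L T U) : Step L U T := by
  obtain ⟨t, ht, s, hs, htT, hsT, rfl, h1, h2⟩ := h
  have hts : t ≠ s := by rintro rfl; exact hsT htT
  refine ⟨s, hs, t, ht, Set.mem_insert .., by simp [hts], ?_, h2, h1⟩
  ext v
  by_cases h1 : v = t <;> by_cases h2 : v = s <;> simp_all

/-- Steps on `L` alter the set only at nodes of `L`. Every set along the chain thus agrees with `T`
elsewhere, which is what `hT` needs to extend each intermediate net to `M`. -/
theorem chain_lift (hLM : L ⊆ M) (hT : ∀ U, (∀ v ∉ nodes L, v ∈ T ↔ v ∈ U) → ANet U L → ANet U M)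
    {U : Set ℕ} (h : Relation.ReflTransGen (Step L) T U) :
    Relation.ReflTransGen (Step M) T U ∧ ∀ v ∉ nodes L, v ∈ T ↔ v ∈ U := by
  induction h with
  | refl => exact ⟨.refl, fun _ _ => Iff.rfl⟩
  | @tail U W _ hUW ih =>
    obtain ⟨t, ht, s, hs, htT, hsT, rfl, h1, h2⟩ := hUW
    have hW : ∀ v ∉ nodes L, v ∈ T ↔ v ∈ insert s (U \ {t}) := by
      intro v hv
      have : v ≠ s := by rintro rfl; exact hv hs
      have : v ≠ t := by rintro rfl; exact hv ht
      simp [ih.2 v hv, *]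
    exact ⟨ih.1.tail ⟨t, nodes_mono hLM ht, s, nodes_mono hLM hs, htT, hsT, rfl, hT U ih.2 h1,
      hT _ hW h2⟩, hW⟩

/-- The set `T₀` of the derivation is fixed during the induction, whereas the starting point `T`
must vary: in the tensor case the second half is treated after the first has been altered. Hence
agreement of `T₀` with `T` is required on `nodes L` only. -/
theorem chain_of_agree {T₀ : Set ℕ} (h : ANet T₀ L) (hT₀ : ∀ v ∈ nodes L, v ∈ T₀ ↔ v ∈ T)
    (h' : ANet T' L) (hTT' : ∀ v ∉ nodes L, v ∈ T ↔ v ∈ T') :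
    Relation.ReflTransGen (Step L) T T' := by
  induction h generalizing T T' with
  | ident i j =>
    have : T = T' := by ext v; exact hTT' v (by simp [nodes])
    exact this ▸ .refl
  | @par L i j k h hi hj hk hT ih =>
    rw [hT₀ k ⟨i, j, Set.mem_insert ..⟩] at hT
    have hn : node i j k ∈ insert (node i j k) L := Set.mem_insert ..
    have hnL : node i j k ∉ L := fun h => hk (mem_verts_of_node h)
    have hP : k ∉ prems (insert (node i j k) L) := by
      rintro ⟨_, rfl | ha, hv⟩
      · rcases hv with rfl | rfl <;> contradiction
      · exact hk (h.prem_subset _ ha hv)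
    -- If the last link is a par in the target too, it is removed from both nets, and the chain for
    -- the rest is lifted.
    have key : ∀ T', ANet T' (insert (node i j k) L) → k ∉ T' →
        (∀ v ∉ nodes (insert (node i j k) L), v ∈ T ↔ v ∈ T') →
        Relation.ReflTransGen (Step (insert (node i j k) L)) T T' := by
      intro T' h' hkT' hTT'
      obtain ⟨L₀, e, h₀, hk₀⟩ := h'.remove_par hn hkT' hP
      obtain rfl := insert_cancel e hnL fun h => hk₀ (mem_verts_of_node h)
      refine (chain_lift (Set.subset_insert ..) ?_
        (ih (fun v hv => hT₀ v (nodes_mono (Set.subset_insert ..) hv)) h₀ ?_)).1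
      · intro U hU hUL
        exact .par hUL hi hj hk (by rwa [← hU k fun h => hk (nodes_subset_verts _ h)])
      · intro v hv
        by_cases e : v = k
        · subst e; simp [hT, hkT']
        · refine hTT' v ?_
          rintro ⟨a, b, hab | hab⟩
          · exact e (Arc.node.inj hab).2.2
          · exact hv ⟨a, b, hab⟩
    by_cases hkT' : k ∈ T'
    -- Here `k` is a tensor of the target. Splitting would disconnect the net `L`, so `k` is
    -- exchangeable with a par `y`. The exchanged net is reached by `key`, and the exchange is then
    -- undone.
    · rcases h'.splits_or_exchange hn hkT' hP with
        ⟨M, N, e, hM, hN, hd, hi', hj', hkM, hkN⟩ | ⟨y, hy, hyT, hy'⟩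
      · obtain rfl := insert_cancel e hnL fun h => h.elim (fun h => hkM (mem_verts_of_node h))
          fun h => hkN (mem_verts_of_node h)
        exact (h.not_union hM hN hd hi' hj').elim
      · have hkn : k ∈ nodes (insert (node i j k) L) := ⟨i, j, hn⟩
        have hst : Step (insert (node i j k) L) T' (insert y (T' \ {k})) :=
          ⟨k, hkn, y, hy, hkT', hyT, rfl, h', hy'⟩
        have hky : k ≠ y := by rintro rfl; exact hyT hkT'
        refine (key _ hy' (by simp [hky]) fun v hv => ?_).tail hst.symm
        have : v ≠ k := by rintro rfl; exact hv hkn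
        have : v ≠ y := by rintro rfl; exact hv hy
        simp [hTT' v hv, *]
    · exact key T' h' hkT' hTT'
  | @tens L M i j k hL hM hd hi hj hkL hkM hT ihL ihM =>
    rw [hT₀ k ⟨i, j, Set.mem_insert ..⟩] at hT
    have hn : node i j k ∈ insert (node i j k) (L ∪ M) := Set.mem_insert ..
    have hnL : node i j k ∉ L ∪ M := fun h => h.elim (fun h => hkL (mem_verts_of_node h))
          fun h => hkM (mem_verts_of_node h)
    have hP : k ∉ prems (insert (node i j k) (L ∪ M)) := by
      rintro ⟨_, rfl | ha | ha, hv⟩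
      · rcases hv with rfl | rfl <;> contradiction
      · exact hkL (hL.prem_subset _ ha hv)
      · exact hkM (hM.prem_subset _ ha hv)
    -- As a par, `k` could be removed, leaving a net on the disconnected set `L ∪ M`.
    have key : ∀ T', ANet T' (insert (node i j k) (L ∪ M)) → k ∈ T' := by
      intro T' h'
      by_contra hkT'
      obtain ⟨L₀, e, h₀, hk₀⟩ := h'.remove_par hn hkT' hP
      obtain rfl := insert_cancel e hnL fun h => hk₀ (mem_verts_of_node h)
      exact h₀.not_union hL hM hd hi hj
    have hkT' := key T' h'
    rcases h'.splits_or_exchange hn hkT' hP with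
      ⟨P, Q, e, hPn, hQ, hd', hi', hj', hkP, hkQ⟩ | ⟨y, hy, hyT, hy'⟩
    · have e := insert_cancel e hnL fun h => h.elim (fun h => hkP (mem_verts_of_node h))
          fun h => hkQ (mem_verts_of_node h)
      -- Both decompositions consist of connected parts, and the parts containing `i`, respectively
      -- `j`, must coincide.
      have hLe : L = P := Set.Subset.antisymm
        (hL.subset_of_disjoint_parts hPn.prem_subset hQ.prem_subset hd'
          (e ▸ Set.subset_union_left) hi hi')
        (hPn.subset_of_disjoint_parts hL.prem_subset hM.prem_subset hd
          (e ▸ Set.subset_union_left) hi' hi)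
      have hMe : M = Q := Set.Subset.antisymm
        (hM.subset_of_disjoint_parts hQ.prem_subset hPn.prem_subset hd'.symm
          (by rw [Set.union_comm Q, ← e]; exact Set.subset_union_right) hj hj')
        (hQ.subset_of_disjoint_parts hM.prem_subset hL.prem_subset hd.symm
          (by rw [Set.union_comm M, e]; exact Set.subset_union_right) hj' hj)
      subst hLe hMe
      have hsub : L ⊆ insert (node i j k) (L ∪ M) := by intro x hx; simp [hx]
      have hsub' : M ⊆ insert (node i j k) (L ∪ M) := by intro x hx; simp [hx]
      have hdn : ∀ v ∈ nodes M, v ∉ nodes L := fun v h1 h2 =>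
        Set.disjoint_left.1 hd (nodes_subset_verts _ h2) (nodes_subset_verts _ h1)
      have hkLn : k ∉ nodes L := fun h => hkL (nodes_subset_verts _ h)
      have hkMn : k ∉ nodes M := fun h => hkM (nodes_subset_verts _ h)
      -- The halfway point: already `T'` on `L`, still `T` elsewhere. The chain goes from `T` to `U`
      -- inside `L`, then from `U` to `T'` inside `M`.
      let U : Set ℕ := {v | (v ∈ nodes L ∧ v ∈ T') ∨ (v ∉ nodes L ∧ v ∈ T)}
      have hUL : ∀ v ∈ nodes L, v ∈ T' ↔ v ∈ U := by intro v hv; simp [U, hv]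
      have hUT : ∀ v ∉ nodes L, v ∈ T ↔ v ∈ U := by intro v hv; simp [U, hv]
      have hTL : ∀ v ∈ nodes L, v ∈ T₀ ↔ v ∈ T := fun v hv => hT₀ v (nodes_mono hsub hv)
      have hTM : ∀ v ∈ nodes M, v ∈ T₀ ↔ v ∈ T := fun v hv => hT₀ v (nodes_mono hsub' hv)
      have hMU : ∀ v ∈ nodes M, v ∈ T₀ ↔ v ∈ U :=
        fun v hv => (hTM v hv).trans (hUT v (hdn v hv))
      refine (chain_lift hsub ?_ (ihL hTL (hPn.congr hUL) hUT)).1.trans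
        (chain_lift hsub' ?_ (ihM hMU hQ ?_)).1
      · intro W hW hWL
        exact .tens hWL (hM.congr fun v hv => (hTM v hv).trans (hW v (hdn v hv))) hd hi hj hkL hkM
          ((hW k hkLn).1 hT)
      · intro W hW hWM
        exact .tens (hPn.congr fun v hv => (hUL v hv).trans (hW v fun h => hdn v h hv)) hWM hd hi hj
          hkL hkM ((hW k hkMn).1 ((hUT k hkLn).1 hT))
      · intro v hv
        by_cases h1 : v ∈ nodes L
        · exact (hUL v h1).symm
        · rw [← hUT v h1]
          by_cases e : v = k
          · subst e; simp [hT, hkT']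
          · refine hTT' v ?_
            rintro ⟨a, b, hab | hab | hab⟩
            · exact e (Arc.node.inj hab).2.2
            · exact h1 ⟨a, b, hab⟩
            · exact hv ⟨a, b, hab⟩
    -- The exchange would produce a net in which `k` is a par, against `key`.
    · have hky : k ≠ y := by rintro rfl; exact hyT hkT'
      exact absurd (key _ hy') (by simp [hky])

/-- Two nets on the same stripped links are connected by exchanges through nets. -/
theorem chain (h : ANet T L) (h' : ANet T' L) (hTT' : ∀ v ∉ nodes L, v ∈ T ↔ v ∈ T') :
    Relation.ReflTransGen (Step L) T T' :=
  h.chain_of_agree (fun _ _ => Iff.rfl) h' hTT'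

/-! ### Renaming of indices -/

/-- Nets are stable under injective renamings of the indices. -/
theorem map {g : ℕ → ℕ} (h : ANet T L) (hg : Set.InjOn g (verts L))
    (hT : ∀ v ∈ nodes L, v ∈ T ↔ g v ∈ T') : ANet T' (Arc.map g '' L) := by
  induction h with
  | ident i j => simpa [Arc.map] using ANet.ident (g i) (g j)
  | @par L i j k h hi hj hk hkT ih =>
    rw [verts_insert_node] at hg
    rw [Set.image_insert_eq]
    refine .par (ih (hg.mono (Set.subset_insert ..)) fun v hv => hT v ?_)
      (verts_image g L ▸ ⟨i, hi, rfl⟩) (verts_image g L ▸ ⟨j, hj, rfl⟩) ?_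
      (by rwa [← hT k ⟨i, j, Set.mem_insert ..⟩])
    · exact nodes_mono (Set.subset_insert ..) hv
    · rw [verts_image]
      rintro ⟨v, hv, e⟩
      exact hk (hg (Or.inr hv) (Or.inl rfl) e ▸ hv)
  | @tens L M i j k hL hM hd hi hj hkL hkM hkT ihL ihM =>
    rw [verts_insert_node, verts_union] at hg
    rw [Set.image_insert_eq, Set.image_union]
    have hsub : L ⊆ insert (node i j k) (L ∪ M) := by intro x hx; simp [hx]
    have hsub' : M ⊆ insert (node i j k) (L ∪ M) := by intro x hx; simp [hx]
    refine .tens (ihL (hg.mono ?_) fun v hv => hT v (nodes_mono hsub hv))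
      (ihM (hg.mono ?_) fun v hv => hT v (nodes_mono hsub' hv)) ?_
      (verts_image g L ▸ ⟨i, hi, rfl⟩) (verts_image g M ▸ ⟨j, hj, rfl⟩) ?_ ?_
      (by rwa [← hT k ⟨i, j, Set.mem_insert ..⟩])
    · intro v hv; simp [hv]
    · intro v hv; simp [hv]
    · rw [verts_image, verts_image, Set.disjoint_left]
      rintro _ ⟨v, hv, rfl⟩ ⟨w, hw, e⟩
      exact Set.disjoint_left.1 hd hv
        (hg (Or.inr (Or.inr hw)) (Or.inr (Or.inl hv)) e ▸ hw)
    · rw [verts_image]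
      rintro ⟨v, hv, e⟩
      exact hkL (hg (Or.inr (Or.inl hv)) (Or.inl rfl) e ▸ hv)
    · rw [verts_image]
      rintro ⟨v, hv, e⟩
      exact hkM (hg (Or.inr (Or.inr hv)) (Or.inl rfl) e ▸ hv)

end ANet

/-! ### Proof structures and their stripped links -/

/-- The stripped link. -/
def Link.arc : Link → Arc
  | Link.ident i j => Arc.ident i j
  | Link.tens _ _ i j k => Arc.node i j k
  | Link.par _ _ i j k => Arc.node i j k

theorem Link.mem_concl_arc {L : Link} {v : ℕ} :
    v ∈ L.arc.concl ↔ ∃ A, (A, v) ∈ L.conclusions := by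
  cases L <;> simp [Link.arc, Arc.concl, Link.conclusions, exists_or]

theorem Link.mem_prem_arc {L : Link} {v : ℕ} :
    v ∈ L.arc.prem ↔ ∃ A, (A, v) ∈ L.premises := by
  cases L <;> simp [Link.arc, Arc.prem, Link.premises, exists_or]

namespace ProofStructure

variable {Θ Θ' : ProofStructure} {L L' : Link} {A B : Formula} {i j k v : ℕ} {T : Set ℕ}
  {M : Set Arc}

/-- The stripped links of a proof structure. -/
def arcs (Θ : ProofStructure) : Set Arc := {a | ∃ L ∈ Θ.lnk, L.arc = a}

/-- The indices of the conclusions of the tensor links. -/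
def tensors (Θ : ProofStructure) : Set ℕ := {k | ∃ A B i j, Link.tens A B i j k ∈ Θ.lnk}

theorem formula_eq (hA : (A, v) ∈ Θ.fml) (hB : (B, v) ∈ Θ.fml) : A = B :=
  congrArg Prod.fst (Θ.index_inj _ hA _ hB rfl)

theorem mem_verts_arcs : v ∈ verts Θ.arcs ↔ ∃ A, (A, v) ∈ Θ.fml := by
  constructor
  · rintro ⟨_, ⟨L, hL, rfl⟩, hv⟩
    obtain ⟨A, hA⟩ := Link.mem_concl_arc.1 hv
    exact ⟨A, Θ.conclusions_mem L hL _ hA⟩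
  · rintro ⟨A, hA⟩
    obtain ⟨L, ⟨hL, hAL⟩, -⟩ := Θ.conclusion_unique _ hA
    exact ⟨_, ⟨L, hL, rfl⟩, Link.mem_concl_arc.2 ⟨A, hAL⟩⟩

/-- An index determines its occurrence, and an occurrence is a conclusion of only one link. -/
theorem link_eq (hL : L ∈ Θ.lnk) (hL' : L' ∈ Θ.lnk) (h : v ∈ L.arc.concl)
    (h' : v ∈ L'.arc.concl) : L = L' := by
  obtain ⟨A, hA⟩ := Link.mem_concl_arc.1 h
  obtain ⟨B, hB⟩ := Link.mem_concl_arc.1 h'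
  have hAm := Θ.conclusions_mem L hL _ hA
  obtain rfl := formula_eq hAm (Θ.conclusions_mem L' hL' _ hB)
  exact (Θ.conclusion_unique _ hAm).unique ⟨hL, hA⟩ ⟨hL', hB⟩

theorem arc_injOn (hL : L ∈ Θ.lnk) (hL' : L' ∈ Θ.lnk) (h : L.arc = L'.arc) : L = L' := by
  obtain ⟨v, hv⟩ := L.arc.concl_nonempty
  exact link_eq hL hL' hv (h ▸ hv)

theorem arc_eq {a b : Arc} (ha : a ∈ Θ.arcs) (hb : b ∈ Θ.arcs) (h : v ∈ a.concl)
    (h' : v ∈ b.concl) : a = b := by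
  obtain ⟨L, hL, rfl⟩ := ha
  obtain ⟨L', hL', rfl⟩ := hb
  rw [link_eq hL hL' h h']

theorem tensors_subset_nodes (Θ : ProofStructure) : Θ.tensors ⊆ nodes Θ.arcs :=
  fun _ ⟨_, _, i, j, h⟩ => ⟨i, j, _, h, rfl⟩

theorem notMem_tensors_of_par (h : Link.par A B i j k ∈ Θ.lnk) : k ∉ Θ.tensors := by
  rintro ⟨A', B', i', j', h'⟩
  simpa using link_eq (v := k) h h' (Set.mem_singleton _) (Set.mem_singleton _)

theorem exists_link_of_node (h : node i j k ∈ Θ.arcs) :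
    (k ∈ Θ.tensors ∧ ∃ A B, Link.tens A B i j k ∈ Θ.lnk) ∨
      (k ∉ Θ.tensors ∧ ∃ A B, Link.par A B i j k ∈ Θ.lnk) := by
  obtain ⟨L, hL, e⟩ := h
  cases L with
  | ident => simp [Link.arc] at e
  | tens A B =>
    simp only [Link.arc, node.injEq] at e
    obtain ⟨rfl, rfl, rfl⟩ := e
    exact Or.inl ⟨⟨_, _, _, _, hL⟩, A, B, hL⟩
  | par A B =>
    simp only [Link.arc, node.injEq] at e
    obtain ⟨rfl, rfl, rfl⟩ := e
    exact Or.inr ⟨notMem_tensors_of_par hL, A, B, hL⟩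

theorem tens_mem_of_node (h : node i j k ∈ Θ.arcs) (hk : k ∈ Θ.tensors) :
    ∃ A B, Link.tens A B i j k ∈ Θ.lnk :=
  (exists_link_of_node h).elim And.right fun h => absurd hk h.1

theorem par_mem_of_node (h : node i j k ∈ Θ.arcs) (hk : k ∉ Θ.tensors) :
    ∃ A B, Link.par A B i j k ∈ Θ.lnk :=
  (exists_link_of_node h).elim (fun h => absurd h.1 hk) And.right

theorem ident_mem (h : Arc.ident i j ∈ Θ.arcs) : Link.ident i j ∈ Θ.lnk := by
  obtain ⟨L, hL, e⟩ := h
  cases L <;> simp [Link.arc] at e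
  obtain ⟨rfl, rfl⟩ := e
  exact hL

theorem mem_verts_of_fml (h : (A, v) ∈ Θ.fml) : v ∈ verts Θ.arcs :=
  mem_verts_arcs.2 ⟨A, h⟩

/-- The stripped links of a proof net form a net. -/
theorem Sequentializable.anet (h : Sequentializable Θ) : ANet Θ.tensors Θ.arcs := by
  induction h with
  | ident Θ L hL hlnk =>
    obtain ⟨i, j, rfl⟩ := hL
    have : Θ.arcs = {Arc.ident i j} := by ext a; simp [arcs, hlnk, Link.arc, eq_comm]
    exact this ▸ .ident i j
  | par Θ Θ₀ A B i j k hL hconc hfml hlnk hseq ih =>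
    have e : Θ.lnk = insert (Link.par A B i j k) Θ₀.lnk := by
      rw [hlnk, Finset.insert_sdiff_self_of_mem hL]
    have ha : Θ.arcs = insert (node i j k) Θ₀.arcs := by
      ext a; simp [arcs, e, Link.arc, eq_comm]
    have ht : Θ.tensors = Θ₀.tensors := by
      ext v; simp [tensors, e]
    have hk := notMem_tensors_of_par hL
    have hp := Θ.premises_mem _ hL
    have hne : ∀ x ∈ (Link.par A B i j k).premises, x ≠ (Formula.par A B, k) := by
      rintro x hx rfl
      exact hconc.2 _ hL hx
    have hv : ∀ x ∈ (Link.par A B i j k).premises, x.2 ∈ verts Θ₀.arcs := fun x hx =>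
      mem_verts_of_fml (A := x.1) (by simp [hfml, hp x hx, hne x hx])
    rw [ha, ht]
    refine .par ih (hv (A, i) (by simp [Link.premises])) (hv (B, j) (by simp [Link.premises])) ?_
      (ht ▸ hk)
    intro h
    obtain ⟨C, hC⟩ := mem_verts_arcs.1 h
    rw [hfml, Finset.mem_sdiff] at hC
    exact hC.2 (by rw [formula_eq hC.1 hconc.1]; simp)
  | tens Θ Θ₁ Θ₂ A B i j k hL hconc hleft hright hd h₁ h₂ hfml hld hl₁ hl₂ hlnk hs₁ hs₂ ih₁ ih₂ =>
    have ha : Θ.arcs = insert (node i j k) (Θ₁.arcs ∪ Θ₂.arcs) := by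
      ext a
      simp [arcs, hlnk, Link.arc, or_and_right, exists_or, eq_comm, or_comm, or_left_comm]
    have ht : ∀ v, v ∈ Θ.tensors ↔ v = k ∨ v ∈ Θ₁.tensors ∨ v ∈ Θ₂.tensors := by
      intro v
      constructor
      · rintro ⟨A', B', i', j', h⟩
        simp only [hlnk, Finset.mem_union, Finset.mem_singleton, Link.tens.injEq] at h
        rcases h with (h | h) | h
        · exact Or.inr (Or.inl ⟨_, _, _, _, h⟩)
        · exact Or.inr (Or.inr ⟨_, _, _, _, h⟩)
        · exact Or.inl h.2.2.2.2
      · rintro (rfl | ⟨_, _, _, _, h⟩ | ⟨_, _, _, _, h⟩)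
        · exact ⟨_, _, _, _, hL⟩
        · exact ⟨_, _, _, _, by rw [hlnk]; exact Finset.mem_union_left _ (Finset.mem_union_left _ h)⟩
        · exact ⟨_, _, _, _, by rw [hlnk]; exact Finset.mem_union_left _ (Finset.mem_union_right _ h)⟩
    have hs1 : ∀ x ∈ Θ₁.fml, x ∈ Θ.fml := fun x hx => by simp [hfml, hx]
    have hs2 : ∀ x ∈ Θ₂.fml, x ∈ Θ.fml := fun x hx => by simp [hfml, hx]
    have hk₁ : k ∉ verts Θ₁.arcs := by
      intro h
      obtain ⟨C, hC⟩ := mem_verts_arcs.1 h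
      exact h₁ (formula_eq (hs1 _ hC) hconc.1 ▸ hC)
    have hk₂ : k ∉ verts Θ₂.arcs := by
      intro h
      obtain ⟨C, hC⟩ := mem_verts_arcs.1 h
      exact h₂ (formula_eq (hs2 _ hC) hconc.1 ▸ hC)
    have hdv : Disjoint (verts Θ₁.arcs) (verts Θ₂.arcs) := by
      rw [Set.disjoint_left]
      intro v h h'
      obtain ⟨C, hC⟩ := mem_verts_arcs.1 h
      obtain ⟨D, hD⟩ := mem_verts_arcs.1 h'
      exact Finset.disjoint_left.1 hd hC (formula_eq (hs2 _ hD) (hs1 _ hC) ▸ hD)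
    have hn : ∀ {Ψ : ProofStructure} {v}, v ∈ Ψ.tensors → v ∈ verts Ψ.arcs := fun h =>
      nodes_subset_verts _ (tensors_subset_nodes _ h)
    rw [ha]
    -- At nodes of one part, the tensors of the whole are those of that part: the vertex sets are
    -- disjoint and `k` lies in neither.
    refine .tens (ih₁.congr fun v hv => ?_) (ih₂.congr fun v hv => ?_) hdv
      (mem_verts_of_fml hleft) (mem_verts_of_fml hright) hk₁ hk₂ ((ht k).2 (Or.inl rfl))
    · rw [ht]
      refine ⟨fun h => Or.inr (Or.inl h), ?_⟩
      have hv := nodes_subset_verts _ hv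
      rintro (rfl | h | h)
      · exact absurd hv hk₁
      · exact h
      · exact absurd (hn h) (Set.disjoint_left.1 hdv hv)
    · rw [ht]
      refine ⟨fun h => Or.inr (Or.inr h), ?_⟩
      have hv := nodes_subset_verts _ hv
      rintro (rfl | h | h)
      · exact absurd hv hk₂
      · exact absurd (hn h) (Set.disjoint_right.1 hdv hv)
      · exact h

open Classical in
/-- The part of a proof structure given by a set of stripped links which is closed under going to
the premises. -/
noncomputable def restrict (Θ : ProofStructure) (M : Set Arc) (hM : M ⊆ Θ.arcs)
    (hp : ∀ a ∈ M, a.prem ⊆ verts M) : ProofStructure where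
  fml := Θ.fml.filter fun x => x.2 ∈ verts M
  lnk := Θ.lnk.filter fun L => L.arc ∈ M
  premises_mem := by
    intro L hL x hx
    rw [Finset.mem_filter] at hL ⊢
    exact ⟨Θ.premises_mem L hL.1 x hx, hp _ hL.2 (Link.mem_prem_arc.2 ⟨x.1, hx⟩)⟩
  conclusions_mem := by
    intro L hL x hx
    rw [Finset.mem_filter] at hL ⊢
    exact ⟨Θ.conclusions_mem L hL.1 x hx, _, hL.2, Link.mem_concl_arc.2 ⟨x.1, hx⟩⟩
  premises_nodup L hL := Θ.premises_nodup L (Finset.mem_filter.1 hL).1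
  index_inj x hx y hy := Θ.index_inj x (Finset.mem_filter.1 hx).1 y (Finset.mem_filter.1 hy).1
  premise_unique x hx L hL L' hL' := Θ.premise_unique x (Finset.mem_filter.1 hx).1
    L (Finset.mem_filter.1 hL).1 L' (Finset.mem_filter.1 hL').1
  conclusion_unique := by
    intro x hx
    rw [Finset.mem_filter] at hx
    obtain ⟨hx, a, ha, hxa⟩ := hx
    obtain ⟨L, ⟨hL, hxL⟩, hu⟩ := Θ.conclusion_unique x hx
    -- The link concluding `x` in `Θ` survives the restriction, since its stripped form shares a
    -- conclusion with `a` and so equals it.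
    have hLa : L.arc = a := arc_eq ⟨L, hL, rfl⟩ (hM ha) (Link.mem_concl_arc.2 ⟨x.1, hxL⟩) hxa
    exact ⟨L, ⟨Finset.mem_filter.2 ⟨hL, hLa ▸ ha⟩, hxL⟩,
      fun L' h => hu L' ⟨(Finset.mem_filter.1 h.1).1, h.2⟩⟩

section restrict

variable {hM : M ⊆ Θ.arcs} {hp : ∀ a ∈ M, a.prem ⊆ verts M}

theorem mem_fml_restrict {x : IndexedFormula} :
    x ∈ (Θ.restrict M hM hp).fml ↔ x ∈ Θ.fml ∧ x.2 ∈ verts M := by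
  simp [restrict]

theorem mem_lnk_restrict : L ∈ (Θ.restrict M hM hp).lnk ↔ L ∈ Θ.lnk ∧ L.arc ∈ M := by
  simp [restrict]

theorem arcs_restrict : (Θ.restrict M hM hp).arcs = M := by
  ext a
  constructor
  · rintro ⟨L, hL, rfl⟩
    exact (mem_lnk_restrict.1 hL).2
  · intro ha
    obtain ⟨L, hL, rfl⟩ := hM ha
    exact ⟨L, mem_lnk_restrict.2 ⟨hL, ha⟩, rfl⟩

theorem mem_tensors_restrict (hv : v ∈ nodes M) :
    v ∈ (Θ.restrict M hM hp).tensors ↔ v ∈ Θ.tensors := by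
  constructor
  · rintro ⟨A, B, i, j, h⟩
    exact ⟨A, B, i, j, (mem_lnk_restrict.1 h).1⟩
  · intro h
    obtain ⟨i, j, hij⟩ := hv
    obtain ⟨A, B, hAB⟩ := tens_mem_of_node (hM hij) h
    exact ⟨A, B, i, j, mem_lnk_restrict.2 ⟨hAB, hij⟩⟩

end restrict

theorem mem_prems_of_mem {x : IndexedFormula} (hL : L ∈ Θ.lnk) (hx : x ∈ L.premises) :
    x.2 ∈ prems Θ.arcs :=
  ⟨_, ⟨L, hL, rfl⟩, Link.mem_prem_arc.2 ⟨x.1, hx⟩⟩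

/-- A proof structure whose stripped links form a net is a proof net. -/
theorem sequentializable_of_anet {N : Set Arc} (h : ANet T N) (hN : Θ.arcs = N)
    (hT : ∀ v ∈ nodes N, v ∈ T ↔ v ∈ Θ.tensors) : Sequentializable Θ := by
  induction h generalizing Θ with
  | ident i j =>
    refine .ident Θ (Link.ident i j) ⟨i, j, rfl⟩ ?_
    ext L
    have hm : Arc.ident i j ∈ Θ.arcs := hN ▸ rfl
    rw [Finset.mem_singleton]
    constructor
    · intro hL
      have : L.arc ∈ Θ.arcs := ⟨L, hL, rfl⟩
      rw [hN] at this
      exact arc_injOn hL (ident_mem hm) this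
    · rintro rfl
      exact ident_mem hm
  | @par N i j k h hi hj hk hkT ih =>
    have hm : node i j k ∈ Θ.arcs := hN ▸ Set.mem_insert ..
    have hsub : N ⊆ Θ.arcs := hN ▸ Set.subset_insert ..
    rw [hT k ⟨i, j, Set.mem_insert ..⟩] at hkT
    obtain ⟨A, B, hL⟩ := par_mem_of_node hm hkT
    have hc := Θ.conclusions_mem _ hL _ (List.mem_singleton_self _)
    -- The last link is terminal: every premise is a vertex of `N`, and `k` is not.
    have hkP : k ∉ prems Θ.arcs := by
      rw [hN]
      rintro ⟨_, rfl | ha, hv⟩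
      · rcases hv with rfl | rfl <;> contradiction
      · exact hk (h.prem_subset _ ha hv)
    refine .par Θ (Θ.restrict N hsub h.prem_subset) A B i j k hL
      ⟨hc, fun L hL hx => hkP (mem_prems_of_mem hL hx)⟩ ?_ ?_ (ih arcs_restrict fun v hv =>
        (hT v (nodes_mono (Set.subset_insert ..) hv)).trans (mem_tensors_restrict hv).symm)
    · ext ⟨C, v⟩
      rw [mem_fml_restrict, Finset.mem_sdiff, Finset.mem_singleton]
      refine and_congr_right fun hx => ?_
      have hv := mem_verts_of_fml hx
      rw [hN, verts_insert_node] at hv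
      constructor
      · rintro h ⟨⟩
        exact hk h
      · intro hne
        refine hv.resolve_left ?_
        rintro rfl
        exact hne (by rw [formula_eq hx hc])
    · ext L
      rw [mem_lnk_restrict, Finset.mem_sdiff, Finset.mem_singleton]
      refine and_congr_right fun hx => ?_
      have hv : L.arc ∈ Θ.arcs := ⟨L, hx, rfl⟩
      rw [hN] at hv
      constructor
      · rintro h rfl
        exact hk (mem_verts_of_node h)
      · exact fun hne => hv.resolve_left fun e => hne (arc_injOn hx hL e)
  | @tens N N' i j k h h' hd hi hj hk hk' hkT ih ih' =>
    have hm : node i j k ∈ Θ.arcs := hN ▸ Set.mem_insert ..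
    have hs : N ⊆ insert (node i j k) (N ∪ N') := by intro x hx; simp [hx]
    have hs' : N' ⊆ insert (node i j k) (N ∪ N') := by intro x hx; simp [hx]
    have hsub : N ⊆ Θ.arcs := hN ▸ hs
    have hsub' : N' ⊆ Θ.arcs := hN ▸ hs'
    rw [hT k ⟨i, j, Set.mem_insert ..⟩] at hkT
    obtain ⟨A, B, hL⟩ := tens_mem_of_node hm hkT
    have hc := Θ.conclusions_mem _ hL _ (List.mem_singleton_self _)
    have hpr := Θ.premises_mem _ hL
    have hkP : k ∉ prems Θ.arcs := by
      rw [hN]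
      rintro ⟨_, rfl | ha | ha, hv⟩
      · rcases hv with rfl | rfl <;> contradiction
      · exact hk (h.prem_subset _ ha hv)
      · exact hk' (h'.prem_subset _ ha hv)
    refine .tens Θ (Θ.restrict N hsub h.prem_subset) (Θ.restrict N' hsub' h'.prem_subset)
      A B i j k hL ⟨hc, fun L hL hx => hkP (mem_prems_of_mem hL hx)⟩
      (mem_fml_restrict.2 ⟨hpr (A, i) (by simp [Link.premises]), hi⟩)
      (mem_fml_restrict.2 ⟨hpr (B, j) (by simp [Link.premises]), hj⟩)
      ?_ (fun hx => hk (mem_fml_restrict.1 hx).2) (fun hx => hk' (mem_fml_restrict.1 hx).2) ?_ ?_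
      (fun hx => hk (mem_verts_of_node (mem_lnk_restrict.1 hx).2))
      (fun hx => hk' (mem_verts_of_node (mem_lnk_restrict.1 hx).2)) ?_
      (ih arcs_restrict fun v hv =>
        (hT v (nodes_mono hs hv)).trans (mem_tensors_restrict hv).symm)
      (ih' arcs_restrict fun v hv =>
        (hT v (nodes_mono hs' hv)).trans (mem_tensors_restrict hv).symm)
    · rw [Finset.disjoint_left]
      intro x hx hx'
      exact Set.disjoint_left.1 hd (mem_fml_restrict.1 hx).2 (mem_fml_restrict.1 hx').2
    · ext ⟨C, v⟩
      simp only [Finset.mem_union, mem_fml_restrict, Finset.mem_singleton]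
      constructor
      · intro hx
        have hv := mem_verts_of_fml hx
        rw [hN, verts_insert_node, verts_union] at hv
        rcases hv with rfl | hv | hv
        · exact Or.inr (by rw [formula_eq hx hc])
        · exact Or.inl (Or.inl ⟨hx, hv⟩)
        · exact Or.inl (Or.inr ⟨hx, hv⟩)
      · rintro ((h | h) | h)
        · exact h.1
        · exact h.1
        · exact h ▸ hc
    · rw [Finset.disjoint_left]
      intro L hx hx'
      obtain ⟨v, hv⟩ := L.arc.concl_nonempty
      exact Set.disjoint_left.1 hd ⟨_, (mem_lnk_restrict.1 hx).2, hv⟩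
        ⟨_, (mem_lnk_restrict.1 hx').2, hv⟩
    · ext L
      simp only [Finset.mem_union, mem_lnk_restrict, Finset.mem_singleton]
      constructor
      · intro hx
        have hv : L.arc ∈ Θ.arcs := ⟨L, hx, rfl⟩
        rw [hN] at hv
        rcases hv with e | hv | hv
        · exact Or.inr (arc_injOn hx hL e)
        · exact Or.inl (Or.inl ⟨hx, hv⟩)
        · exact Or.inl (Or.inr ⟨hx, hv⟩)
      · rintro ((h | h) | h)
        · exact h.1
        · exact h.1
        · exact h ▸ hL

/-! ### The effect of an exchange on stripped links and tensors -/

theorem arc_relabelLink (Θ : ProofStructure) (S : Set Link) (L : Link) :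
    (Θ.relabelLink S L).arc = L.arc := by
  cases L <;> simp only [relabelLink] <;> (try split_ifs) <;> rfl

theorem arcs_replaceLinks (Θ : ProofStructure) (S : Set Link) :
    (Θ.replaceLinks S).arcs = Θ.arcs := by
  ext a
  simp [arcs, replaceLinks, arc_relabelLink]

/-- Relabelling keeps indices, and the conclusion index determines the link, so only the kinds at
`k` and `k'` change. -/
theorem tensors_tpex {A' B' : Formula} {i' j' k' : ℕ} (ht : Link.tens A B i j k ∈ Θ.lnk)
    (hp : Link.par A' B' i' j' k' ∈ Θ.lnk) :
    (Θ.tpex (Link.tens A B i j k) (Link.par A' B' i' j' k')).tensors =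
      insert k' (Θ.tensors \ {k}) := by
  ext v
  constructor
  · rintro ⟨C, D, a, b, h⟩
    obtain ⟨L, hL, e⟩ := Finset.mem_image.1 h
    cases L with
    | ident => simp [relabelLink] at e
    | tens A₁ B₁ i₁ j₁ k₁ =>
      simp only [relabelLink] at e
      split_ifs at e with hS
      simp only [Link.tens.injEq] at e
      obtain ⟨-, -, -, -, rfl⟩ := e
      refine Or.inr ⟨⟨_, _, _, _, hL⟩, ?_⟩
      rintro rfl
      exact hS (Or.inl (link_eq (v := k₁) hL ht (Set.mem_singleton _) (Set.mem_singleton _)))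
    | par A₁ B₁ i₁ j₁ k₁ =>
      simp only [relabelLink] at e
      split_ifs at e with hS
      simp only [Link.tens.injEq] at e
      obtain ⟨-, -, -, -, rfl⟩ := e
      simp only [Set.mem_insert_iff, Set.mem_singleton_iff, reduceCtorEq, false_or,
        Link.par.injEq] at hS
      exact Or.inl hS.2.2.2.2
  · rintro (rfl | ⟨⟨C, D, a, b, h⟩, hv⟩)
    · have := Finset.mem_image_of_mem
        (Θ.relabelLink {Link.tens A B i j k, Link.par A' B' i' j' v}) hp
      simp only [relabelLink] at this
      rw [if_pos (by simp)] at this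
      exact ⟨_, _, _, _, this⟩
    · have := Finset.mem_image_of_mem
        (Θ.relabelLink {Link.tens A B i j k, Link.par A' B' i' j' k'}) h
      simp only [relabelLink] at this
      rw [if_neg (by
        simp only [Set.mem_insert_iff, Set.mem_singleton_iff, reduceCtorEq, or_false,
          Link.tens.injEq]
        exact fun e => hv e.2.2.2.2)] at this
      exact ⟨_, _, _, _, this⟩

end ProofStructure

/-! ### Graph isomorphisms as renamings of indices -/

/-- The inverse isomorphism. -/
def EdgeLabelledDigraph.Iso.symm {G H : EdgeLabelledDigraph} (f : G.Iso H) : H.Iso G where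
  onV := f.onV.symm
  onE := f.onE.symm
  src_eq e := by rw [Equiv.symm_apply_eq, f.src_eq, Equiv.apply_symm_apply]
  tgt_eq e := by rw [Equiv.symm_apply_eq, f.tgt_eq, Equiv.apply_symm_apply]
  labelE_eq e := by rw [f.labelE_eq, Equiv.apply_symm_apply]

namespace ProofStructure

variable {Θ Θ' : ProofStructure}

theorem Equal.refl (Θ : ProofStructure) : Θ.Equal Θ :=
  ⟨{ onV := Equiv.refl _, onE := Equiv.refl _, src_eq := fun _ => rfl, tgt_eq := fun _ => rfl,
     labelE_eq := fun _ => rfl, labelV_eq := fun _ => rfl }⟩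

theorem Equal.symm (h : Θ.Equal Θ') : Θ'.Equal Θ := by
  obtain ⟨f⟩ := h
  exact ⟨{ f.toIso.symm with
    labelV_eq := fun v => by
      have := f.labelV_eq (f.onV.symm v)
      rw [Equiv.apply_symm_apply] at this
      exact this.symm }⟩

open Classical in
/-- The renaming of indices given by a graph isomorphism. -/
noncomputable def indexMap (f : Θ.graph.Iso Θ'.graph) (v : ℕ) : ℕ :=
  -- The value 0 is a mere default: only indices of occurrences of `Θ` matter.
  if h : ∃ A, (A, v) ∈ Θ.fml then (f.onV ⟨v, h⟩).1 else 0

theorem indexMap_eq (f : Θ.graph.Iso Θ'.graph) {v : ℕ} (h : ∃ A, (A, v) ∈ Θ.fml) :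
    indexMap f v = (f.onV ⟨v, h⟩).1 :=
  dif_pos h

theorem indexMap_mem (f : Θ.graph.Iso Θ'.graph) {v : ℕ} (h : v ∈ verts Θ.arcs) :
    indexMap f v ∈ verts Θ'.arcs := by
  rw [mem_verts_arcs] at h ⊢
  rw [indexMap_eq f h]
  exact (f.onV ⟨v, h⟩).2

theorem indexMap_symm (f : Θ.graph.Iso Θ'.graph) {v : ℕ} (h : v ∈ verts Θ.arcs) :
    indexMap f.symm (indexMap f v) = v := by
  have h' := mem_verts_arcs.1 (indexMap_mem f h)
  rw [mem_verts_arcs] at h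
  rw [indexMap_eq f.symm h']
  have : (⟨indexMap f v, h'⟩ : Θ'.graph.V) = f.onV ⟨v, h⟩ := Subtype.ext (indexMap_eq f h)
  rw [this]
  exact congrArg Subtype.val (f.onV.symm_apply_apply ⟨v, h⟩)

/-- The edges of the graph, in terms of the stripped links. -/
def arcEdges : Arc → Set (ℕ × ELabel × ℕ)
  | Arc.ident i j => {(i, ELabel.ident, j)}
  | Arc.node i j k => {(i, ELabel.left, k), (j, ELabel.right, k)}

theorem mem_edges_arc {L : Link} {e : ℕ × ELabel × ℕ} : e ∈ arcEdges L.arc ↔ e ∈ L.edges := by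
  cases L <;> simp [Link.arc, arcEdges, Link.edges]

theorem edges_map {g : ℕ → ℕ} {a : Arc} {e : ℕ × ELabel × ℕ} (h : e ∈ arcEdges a) :
    (g e.1, e.2.1, g e.2.2) ∈ arcEdges (a.map g) := by
  cases a with
  | ident i j => rw [h]; rfl
  | node i j k =>
    rcases h with rfl | rfl
    · exact Or.inl rfl
    · exact Or.inr rfl

theorem exists_edge_indexMap (f : Θ.graph.Iso Θ'.graph) {e : ℕ × ELabel × ℕ} {a : Arc}
    (ha : a ∈ Θ.arcs) (he : e ∈ arcEdges a) :
    ∃ b ∈ Θ'.arcs, (indexMap f e.1, e.2.1, indexMap f e.2.2) ∈ arcEdges b := by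
  have hE : ∃ L ∈ Θ.lnk, e ∈ L.edges := by
    obtain ⟨L, hL, rfl⟩ := ha
    exact ⟨L, hL, mem_edges_arc.1 he⟩
  let e₁ : Θ.graph.E := ⟨e, hE⟩
  have hs := congrArg Subtype.val (f.src_eq e₁)
  have ht := congrArg Subtype.val (f.tgt_eq e₁)
  have hl := f.labelE_eq e₁
  have hs' := (indexMap_eq f (Θ.graph.src e₁).2).trans hs
  have ht' := (indexMap_eq f (Θ.graph.tgt e₁).2).trans ht
  obtain ⟨L, hL, hx⟩ := (f.onE e₁).2
  refine ⟨L.arc, ⟨L, hL, rfl⟩, mem_edges_arc.2 ?_⟩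
  have : (indexMap f e.1, e.2.1, indexMap f e.2.2) = (f.onE e₁).1 :=
    Prod.ext hs' (Prod.ext hl ht')
  rwa [this]

/-- The labelled edges determine the links: the images of the left and right edges of a node end at
the same vertex, which is a conclusion of only one link, so both come from that link. -/
theorem map_indexMap_mem (f : Θ.graph.Iso Θ'.graph) {a : Arc} (ha : a ∈ Θ.arcs) :
    a.map (indexMap f) ∈ Θ'.arcs := by
  cases a with
  | ident i j =>
    obtain ⟨b, hb, h⟩ := exists_edge_indexMap f ha (Set.mem_singleton _)
    cases b with
    | ident i' j' =>
      simp only [arcEdges, Set.mem_singleton_iff, Prod.mk.injEq, true_and] at h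
      simpa [Arc.map, h] using hb
    | node => simp [arcEdges] at h
  | node i j k =>
    obtain ⟨b, hb, h⟩ := exists_edge_indexMap f ha (Or.inl rfl)
    obtain ⟨c, hc, h'⟩ := exists_edge_indexMap f ha (Or.inr rfl)
    cases b with
    | ident i' j' => simp [arcEdges] at h
    | node i₁ j₁ k₁ =>
      cases c with
      | ident i' j' => simp [arcEdges] at h'
      | node i₂ j₂ k₂ =>
        simp [arcEdges] at h h'
        obtain ⟨h1, h2⟩ := h
        obtain ⟨h3, h4⟩ := h'
        have := arc_eq (v := k₁) hb hc rfl (by rw [← h2, h4]; rfl)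
        simp only [node.injEq] at this
        simpa [Arc.map, h1, h2, h3, this] using hb

/-- A vertex label can be read off from the stripped link above the vertex: the position in an
ID-link gives the literal, and membership in `tensors` gives the connective. -/
theorem strip_eq {g : ℕ → ℕ} (hg : ∀ a ∈ Θ.arcs, a.map g ∈ Θ'.arcs)
    (hT : ∀ k ∈ nodes Θ.arcs, k ∈ Θ.tensors ↔ g k ∈ Θ'.tensors) {A A' : Formula} {v : ℕ}
    (hA : (A, v) ∈ Θ.fml) (hA' : (A', g v) ∈ Θ'.fml) : strip A = strip A' := by
  obtain ⟨L, ⟨hL, hAL⟩, -⟩ := Θ.conclusion_unique _ hA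
  have hgL := hg L.arc ⟨L, hL, rfl⟩
  have hc : ∀ L' ∈ Θ'.lnk, ∀ C, (C, g v) ∈ L'.conclusions → A' = C := fun L' hL' C hC =>
    formula_eq hA' (Θ'.conclusions_mem L' hL' _ hC)
  cases L with
  | ident i j =>
    have h := hc _ (ident_mem hgL)
    simp only [Link.conclusions, List.mem_cons, Prod.mk.injEq, List.not_mem_nil, or_false] at hAL h
    rcases hAL with ⟨rfl, rfl⟩ | ⟨rfl, rfl⟩
    · rw [h _ (Or.inl ⟨rfl, rfl⟩)]
    · rw [h _ (Or.inr ⟨rfl, rfl⟩)]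
  | tens B C i j k =>
    simp only [Link.conclusions, List.mem_singleton, Prod.mk.injEq] at hAL
    obtain ⟨rfl, rfl⟩ := hAL
    obtain ⟨D, E, h⟩ := tens_mem_of_node hgL
      ((hT _ ⟨i, j, _, hL, rfl⟩).1 ⟨_, _, _, _, hL⟩)
    rw [hc _ h _ (List.mem_singleton_self _)]
    rfl
  | par B C i j k =>
    simp only [Link.conclusions, List.mem_singleton, Prod.mk.injEq] at hAL
    obtain ⟨rfl, rfl⟩ := hAL
    obtain ⟨D, E, h⟩ := par_mem_of_node hgL
      ((hT _ ⟨i, j, _, hL, rfl⟩).not.1 (notMem_tensors_of_par hL))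
    rw [hc _ h _ (List.mem_singleton_self _)]
    rfl

/-- A renaming of the indices which preserves stripped links and tensors gives an equality of
proof structures. -/
theorem equal_of_rename {g g' : ℕ → ℕ} (hg : ∀ a ∈ Θ.arcs, a.map g ∈ Θ'.arcs)
    (hg' : ∀ a ∈ Θ'.arcs, a.map g' ∈ Θ.arcs)
    (hm : ∀ v ∈ verts Θ.arcs, g v ∈ verts Θ'.arcs) (hm' : ∀ v ∈ verts Θ'.arcs, g' v ∈ verts Θ.arcs)
    (hgg' : ∀ v ∈ verts Θ.arcs, g' (g v) = v) (hg'g : ∀ v ∈ verts Θ'.arcs, g (g' v) = v)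
    (hT : ∀ k ∈ nodes Θ.arcs, k ∈ Θ.tensors ↔ g k ∈ Θ'.tensors) : Θ.Equal Θ' := by
  have hE : ∀ {Ψ Ψ' : ProofStructure} {g : ℕ → ℕ}, (∀ a ∈ Ψ.arcs, a.map g ∈ Ψ'.arcs) →
      ∀ e, (∃ L ∈ Ψ.lnk, e ∈ L.edges) →
        ∃ L ∈ Ψ'.lnk, (g e.1, e.2.1, g e.2.2) ∈ L.edges := by
    rintro Ψ Ψ' g hg e ⟨L, hL, he⟩
    obtain ⟨L', hL', h⟩ := hg _ ⟨L, hL, rfl⟩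
    refine ⟨L', hL', mem_edges_arc.1 ?_⟩
    rw [h]
    exact edges_map (mem_edges_arc.2 he)
  have hs : ∀ e : Θ.graph.E, e.1.1 ∈ verts Θ.arcs := fun e => mem_verts_arcs.2 (Θ.graph.src e).2
  have ht : ∀ e : Θ.graph.E, e.1.2.2 ∈ verts Θ.arcs := fun e => mem_verts_arcs.2 (Θ.graph.tgt e).2
  have hs' : ∀ e : Θ'.graph.E, e.1.1 ∈ verts Θ'.arcs := fun e =>
    mem_verts_arcs.2 (Θ'.graph.src e).2
  have ht' : ∀ e : Θ'.graph.E, e.1.2.2 ∈ verts Θ'.arcs := fun e =>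
    mem_verts_arcs.2 (Θ'.graph.tgt e).2
  exact ⟨{
    onV := {
      toFun := fun v => ⟨g v.1, mem_verts_arcs.1 (hm v.1 (mem_verts_arcs.2 v.2))⟩
      invFun := fun v => ⟨g' v.1, mem_verts_arcs.1 (hm' v.1 (mem_verts_arcs.2 v.2))⟩
      left_inv := fun v => Subtype.ext (hgg' v.1 (mem_verts_arcs.2 v.2))
      right_inv := fun v => Subtype.ext (hg'g v.1 (mem_verts_arcs.2 v.2)) }
    onE := {
      toFun := fun e => ⟨(g e.1.1, e.1.2.1, g e.1.2.2), hE hg e.1 e.2⟩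
      invFun := fun e => ⟨(g' e.1.1, e.1.2.1, g' e.1.2.2), hE hg' e.1 e.2⟩
      left_inv := fun e => Subtype.ext
        (Prod.ext (hgg' _ (hs e)) (Prod.ext rfl (hgg' _ (ht e))))
      right_inv := fun e => Subtype.ext
        (Prod.ext (hg'g _ (hs' e)) (Prod.ext rfl (hg'g _ (ht' e)))) }
    src_eq := fun _ => rfl
    tgt_eq := fun _ => rfl
    labelE_eq := fun _ => rfl
    labelV_eq := fun v => strip_eq hg hT v.2.choose_spec
      (mem_verts_arcs.1 (hm v.1 (mem_verts_arcs.2 v.2))).choose_spec }⟩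

/-! ### From chains of nets to chains of proof nets -/

/-- A step between nets is an exchange of proof structures. -/
theorem exists_exchange_of_step {U : Set ℕ} (h : ANet.Step Θ.arcs Θ.tensors U) :
    ∃ Ψ : ProofStructure, Θ.Exchange Ψ ∧ Ψ.IsProofNet ∧ Ψ.arcs = Θ.arcs ∧ Ψ.tensors = U ∧
      ∀ Θ' : ProofStructure, Θ'.Equal Ψ → Θ.Exchange Θ' := by
  obtain ⟨t, ⟨i, j, ht⟩, s, ⟨i', j', hs⟩, htT, hsT, rfl, -, hU⟩ := h
  obtain ⟨A, B, hAB⟩ := tens_mem_of_node ht htT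
  obtain ⟨A', B', hAB'⟩ := par_mem_of_node hs hsT
  have key : ∀ Θ' : ProofStructure,
      Θ'.Equal (Θ.tpex (Link.tens A B i j t) (Link.par A' B' i' j' s)) → Θ.Exchange Θ' :=
    fun Θ' h => ⟨_, hAB, _, hAB', ⟨_, _, _, _, _, rfl⟩, ⟨_, _, _, _, _, rfl⟩, h⟩
  have hT := tensors_tpex hAB hAB'
  exact ⟨_, key _ (Equal.refl _), sequentializable_of_anet hU (arcs_replaceLinks _ _)
    fun v _ => by rw [hT], arcs_replaceLinks _ _, hT, key⟩

/-- Each step is realized by an actual exchange. The last structure reached is only equal to `Θ'` up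
to isomorphism, but `Exchange` is itself defined up to `Equal`, so the last exchange can be made to
end at `Θ'`. -/
theorem exists_chain {M : Set Arc} {T U : Set ℕ}
    (h : Relation.ReflTransGen (ANet.Step M) T U)
    (hU : ∀ Ψ : ProofStructure, Ψ.arcs = M → Ψ.tensors = U → Ψ.Equal Θ') :
    ∀ Θ : ProofStructure, Θ.arcs = M → Θ.tensors = T → Θ.Equal Θ' ∨
      ∃ l : List ProofStructure, (∀ Ψ ∈ l, Ψ.IsProofNet) ∧
        List.IsChain Exchange (Θ :: (l ++ [Θ'])) := by
  induction h using Relation.ReflTransGen.head_induction_on with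
  | refl => exact fun Θ h h' => Or.inl (hU Θ h h')
  | head hstep _ ih =>
    rintro Θ rfl rfl
    obtain ⟨Ψ, hex, hnet, ha, ht, hE⟩ := exists_exchange_of_step hstep
    rcases ih Ψ ha ht with h | ⟨l, hl, hc⟩
    · exact Or.inr ⟨[], by simp, by simpa using hE _ h.symm⟩
    · refine Or.inr ⟨Ψ :: l, ?_, List.IsChain.cons_cons hex hc⟩
      simpa [hnet] using hl

/-- Two proof nets of the same family are connected by exchanges through proof nets. -/
theorem SameFamily.equal_or_exists_chain (hfam : Θ.SameFamily Θ') (hΘ : Θ.IsProofNet)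
    (hΘ' : Θ'.IsProofNet) : Θ.Equal Θ' ∨
      ∃ l : List ProofStructure, (∀ Ψ ∈ l, Ψ.IsProofNet) ∧
        List.IsChain Exchange (Θ :: (l ++ [Θ'])) := by
  obtain ⟨f⟩ := hfam
  have hgg' := fun v (h : v ∈ Arc.verts Θ.arcs) => indexMap_symm f h
  have hg'g := fun v (h : v ∈ Arc.verts Θ'.arcs) => indexMap_symm f.symm h
  have hg := fun a (h : a ∈ Θ.arcs) => map_indexMap_mem f h
  have hg' := fun a (h : a ∈ Θ'.arcs) => map_indexMap_mem f.symm h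
  set g := indexMap f
  set g' := indexMap f.symm
  have hnode : ∀ k ∈ Arc.nodes Θ'.arcs, g' k ∈ Arc.nodes Θ.arcs := fun k ⟨i, j, h⟩ =>
    ⟨_, _, hg' _ h⟩
  -- The tensors of `Θ'`, transported to the indices of `Θ`.
  let U : Set ℕ := {k | k ∈ Arc.nodes Θ.arcs ∧ g k ∈ Θ'.tensors}
  have himg : Arc.map g' '' Θ'.arcs = Θ.arcs := by
    -- For surjectivity, `a` is compared with its image under `g` followed by `g'`: they share the
    -- conclusion `v`, hence are equal.
    refine Set.Subset.antisymm (Set.image_subset_iff.2 hg') fun a ha => ⟨_, hg a ha, ?_⟩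
    obtain ⟨v, hv⟩ := a.concl_nonempty
    refine arc_eq (v := v) (hg' _ (hg a ha)) ha ?_ hv
    rw [Arc.concl_map, Arc.concl_map]
    exact ⟨g v, ⟨v, hv, rfl⟩, hgg' v ⟨a, ha, hv⟩⟩
  have hnet : ANet U Θ.arcs := by
    rw [← himg]
    refine (Sequentializable.anet hΘ').map ?_ fun v hv => ?_
    · intro v hv w hw e
      rw [← hg'g v hv, ← hg'g w hw]
      exact congrArg g e
    · have : g (g' v) = v := hg'g v (Arc.nodes_subset_verts _ hv)
      simp [U, hnode v hv, this]
  refine exists_chain ((Sequentializable.anet hΘ).chain hnet ?_) ?_ Θ rfl rfl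
  · exact fun v hv => ⟨fun h => absurd (tensors_subset_nodes _ h) hv, fun h => absurd h.1 hv⟩
  -- A structure on the links of `Θ` with tensors `U` is `Θ'` up to the renaming `g`.
  · intro Ψ ha ht
    refine equal_of_rename (g := g) (g' := g') (ha ▸ hg) (ha ▸ hg')
      (fun v hv => indexMap_mem f (ha ▸ hv)) (fun v hv => ha ▸ indexMap_mem f.symm hv)
      (ha ▸ hgg') hg'g fun k hk => ?_
    rw [ht]
    exact ⟨fun h => h.2, fun h => ⟨ha ▸ hk, h⟩⟩

end ProofStructure

end MLL

theorem theorem2 (Θ Θ' : MLL.ProofStructure)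
    (hΘ : Θ.IsProofNet) (hΘ' : Θ'.IsProofNet) (hfam : Θ.SameFamily Θ') :
    Θ.Equal Θ' ∨
      ∃ l : List MLL.ProofStructure, (∀ Ψ ∈ l, Ψ.IsProofNet) ∧
        List.IsChain MLL.ProofStructure.Exchange (Θ :: (l ++ [Θ'])) :=
  hfam.equal_or_exists_chain hΘ hΘ'
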